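/- Let $s>-\tfrac12$. For $N\ge 1$ let $\mathbb{W}_N=\{x\in\mathbb{R}^N: x_1\ge x_2\ge\cdots\ge x_N\}$ and let $\mathsf{M}_N^{(s)}$ be the (Hua–Pickrell) probability measure on $\mathbb{W}_N$ proportional to $$\prod_{j=1}^{N}\frac{1}{(1+x_j^2)^{N+s}}\prod_{1\le i<j\le N}(x_j-x_i)^2\,dx_1\cdots dx_N .$$ Let $\mathbb{H}(N)$ be the space of $N\times N$ complex Hermitian matrices with Lebesgue measure $d\mathbf{H}=\prod_{j}d\mathbf{H}_{jj}\prod_{j<k}d\Re(\mathbf{H}_{jk})\,d\Im(\mathbf{H}_{jk})$, and let $\mathfrak{M}_N^{(s)}$ be the probability measure on $\mathbb{H}(N)$ proportional to $\det(\mathbf{I}+\mathbf{H}^2)^{-s-N}\,d\mathbf{H}$. An infinite Hua–Pickrell random matrix (with parameter $s$) is a random infinite Hermitian matrix $\mathbf{H}=(\mathbf{H}_{ij})_{i,j\ge1}$ such that $(\mathbf{H}_{ij})_{i,j=1}^N$ has law $\mathfrak{M}_N^{(s)}$ for every $N\ge1$. Then there exists, on some probability space, an infinite Hua–Pickrell random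 matrix $\mathbf{H}$ with parameter $s$ such that its diagonal entries $\mathsf{d}_i=\mathbf{H}_{ii}$, $i\ge 1$, form an exchangeable sequence of real random variables (for every $N$, the law of $(\mathsf{d}_1,\dots,\mathsf{d}_N)$ is invariant under all permutations of the indices), each $\mathsf{d}_i$ has the Pearson IV distribution $$\frac{2^{2s}\,\Gamma(s+1)^2}{\pi\,\Gamma(2s+1)}\,\frac{1}{(1+x^2)^{1+s}}\,dx$$ on $\mathbb{R}$, and for every $N\ge 1$ $$\sum_{i=1}^{N}\mathsf{x}_i^{(N)}\overset{\mathrm d}{=}\sum_{i=1}^{N}\mathsf{d}_i ,$$ where $(\mathsf{x}_1^{(N)},\dots,\mathsf{x}_N^{(N)})$ has law $\mathsf{M}_N^{(s)}$. -/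

import Mathlib

namespace HuaPickrell

open MeasureTheory ProbabilityTheory

/-- The entrywise measurable structure on matrices. -/
instance instMeasurableSpaceMatrix {m n α : Type*} [MeasurableSpace α] :
    MeasurableSpace (Matrix m n α) :=
  inferInstanceAs (MeasurableSpace (m → n → α))

/-- The space of Hermitian matrices with rows and columns indexed by `n`. For `n = Fin N` this is
the space of `N × N` Hermitian matrices; for `n = ℕ` it is the space of infinite Hermitian
matrices. -/
abbrev HermitianMatrix (n : Type*) : Type _ := {H : Matrix n n ℂ // H.IsHermitian}

/-- The free coordinates of an `N × N` Hermitian matrix: the real diagonal entries and the complex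
entries strictly above the diagonal. -/
abbrev HermitianCoords (N : ℕ) : Type :=
  (Fin N → ℝ) × ({p : Fin N × Fin N // p.1 < p.2} → ℂ)

/-- The `(i, j)` entry of the Hermitian matrix with the given coordinates. -/
def entryOfCoords {N : ℕ} (c : HermitianCoords N) (i j : Fin N) : ℂ :=
  if h : i < j then c.2 ⟨(i, j), h⟩
  else if h : j < i then star (c.2 ⟨(j, i), h⟩)
  else (c.1 i : ℂ)

/-- The Hermitian matrix with the given coordinates. -/
def hermitianOfCoords {N : ℕ} (c : HermitianCoords N) : HermitianMatrix (Fin N) :=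
  ⟨Matrix.of (entryOfCoords c), by
    ext i j
    rcases lt_trichotomy i j with h | h | h
    · simp [Matrix.conjTranspose_apply, entryOfCoords, h, h.not_gt]
    · subst h
      simp [Matrix.conjTranspose_apply, entryOfCoords]
    · simp [Matrix.conjTranspose_apply, entryOfCoords, h, h.not_gt]⟩

theorem measurable_hermitianOfCoords (N : ℕ) :
    Measurable (hermitianOfCoords : HermitianCoords N → HermitianMatrix (Fin N)) := by
  refine Measurable.subtype_mk (measurable_pi_iff.2 fun i => measurable_pi_iff.2 fun j => ?_)
  change Measurable fun c : HermitianCoords N => entryOfCoords c i j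
  unfold entryOfCoords
  split_ifs with h h'
  · exact (measurable_pi_apply _).comp measurable_snd
  · exact Complex.continuous_conj.measurable.comp ((measurable_pi_apply _).comp measurable_snd)
  · exact Complex.measurable_ofReal.comp ((measurable_pi_apply _).comp measurable_fst)

/-- Lebesgue measure `∏ⱼ dHⱼⱼ ∏_{j<k} d(Re Hⱼₖ) d(Im Hⱼₖ)` on `N × N` Hermitian matrices. -/
noncomputable def hermitianLebesgue (N : ℕ) : Measure (HermitianMatrix (Fin N)) :=
  Measure.map hermitianOfCoords (volume : Measure (HermitianCoords N))

/-- The measure `μ` divided by its total mass (a probability measure when `0 < μ univ < ∞`). -/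
noncomputable def normalize {α : Type*} [MeasurableSpace α] (μ : Measure α) : Measure α :=
  (μ Set.univ)⁻¹ • μ

/-- The Hua-Pickrell measure on `N × N` Hermitian matrices: the probability measure proportional
to `det (I + H²) ^ (-s - N) dH`. (The determinant is a positive real number.) -/
noncomputable def matrixMeasure (N : ℕ) (s : ℝ) : Measure (HermitianMatrix (Fin N)) :=
  normalize ((hermitianLebesgue N).withDensity fun H =>
    ENNReal.ofReal ((1 + H.1 ^ 2).det.re ^ (-s - (N : ℝ))))

/-- The Weyl chamber `x₁ ≥ x₂ ≥ ⋯ ≥ x_N`. -/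
def weylChamber (N : ℕ) : Set (Fin N → ℝ) := {x | Antitone x}

/-- The Vandermonde product `∏_{i<j} (xⱼ - xᵢ)`. -/
def vandermondeProd {N : ℕ} (x : Fin N → ℝ) : ℝ :=
  ∏ i : Fin N, ∏ j ∈ Finset.Ioi i, (x j - x i)

/-- The Hua-Pickrell measure on the Weyl chamber: the probability measure proportional to
`∏ⱼ (1 + xⱼ²) ^ (-(N + s)) Δ(x)² dx`, as a measure on `ℝᴺ` carried by the Weyl chamber. -/
noncomputable def weylMeasure (N : ℕ) (s : ℝ) : Measure (Fin N → ℝ) :=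
  normalize ((volume.restrict (weylChamber N)).withDensity fun x =>
    ENNReal.ofReal ((∏ j : Fin N, 1 / (1 + x j ^ 2) ^ ((N : ℝ) + s)) * vandermondeProd x ^ 2))

/-- The Pearson IV distribution on `ℝ` with parameter `s`. -/
noncomputable def pearsonIV (s : ℝ) : Measure ℝ :=
  volume.withDensity fun x => ENNReal.ofReal
    ((2 : ℝ) ^ (2 * s) * Real.Gamma (s + 1) ^ 2 / (Real.pi * Real.Gamma (2 * s + 1)) *
      (1 / (1 + x ^ 2) ^ (1 + s)))

/-- The top-left `N × N` corner of an infinite Hermitian matrix. -/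
def corner (N : ℕ) (H : HermitianMatrix ℕ) : HermitianMatrix (Fin N) :=
  ⟨H.1.submatrix (fun i : Fin N => (i : ℕ)) (fun i : Fin N => (i : ℕ)), H.2.submatrix _⟩

theorem measurable_corner (N : ℕ) : Measurable (corner N) := by
  refine Measurable.subtype_mk (measurable_pi_iff.2 fun i => measurable_pi_iff.2 fun j => ?_)
  exact (measurable_pi_apply (j : ℕ)).comp
    ((measurable_pi_apply (i : ℕ)).comp measurable_subtype_coe)

/-- `H` is an infinite Hua-Pickrell random matrix with parameter `s`: a random infinite Hermitian
matrix whose `N × N` corner is distributed according to the Hua-Pickrell measure, for every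
`N ≥ 1`. -/
def IsInfiniteHuaPickrell {Ω : Type*} [MeasurableSpace Ω] (s : ℝ) (H : Ω → HermitianMatrix ℕ)
    (P : Measure Ω) : Prop :=
  Measurable H ∧ ∀ N : ℕ, 1 ≤ N → HasLaw (fun ω => corner N (H ω)) (matrixMeasure N s) P

/-- A sequence of real random variables is exchangeable if the joint law of its first `N` terms
is invariant under all permutations, for every `N`. -/
def IsExchangeable {Ω : Type*} [MeasurableSpace Ω] (d : ℕ → Ω → ℝ) (P : Measure Ω) : Prop :=
  (∀ i, Measurable (d i)) ∧ ∀ (N : ℕ) (σ : Equiv.Perm (Fin N)),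
    IdentDistrib (fun ω (i : Fin N) => d (σ i) ω) (fun ω (i : Fin N) => d i ω) P P

end HuaPickrell

/-!
Three ingredients are needed.

**The matrix.** Write a Hermitian matrix of size `N + 1` as a corner `H`, a last column
`v = (1 + iH) w` and a last diagonal entry `t + w* H w`. The Schur complement of the corner in
`1 + iH'` shows that `det (1 + H'²) = det (1 + H²) ((1 + |w|²)² + t²)` (`detOneAddSq_extend`), and
the change of variables `v ↦ w` has Jacobian `det (1 + H²)`. Hence the Hua-Pickrell measure of size
`N + 1` is the image of the product of that of size `N` and an explicit law for `(w, t)`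
(`coordsMeasure_succ`), which is finite for `s > -1/2`. An infinite Hua-Pickrell matrix is therefore
built recursively from independent columns, with no extension theorem beyond infinite products.

**The diagonal.** Conjugation by a permutation matrix has finite order, so it preserves Lebesgue
measure (`map_permuteCoords_volume`), and it preserves `det (1 + H²)`; this gives exchangeability.
The law of the first diagonal entry is read off from the matrix of size one, and the others follow
by exchangeability. The constant is `∫ (1 + x²) ^ (-a) dx = √π Γ(a - 1/2) / Γ(a)` and the
duplication formula.

**The trace.** Both `det (1 + H²)` and the trace are symmetric functions of the eigenvalues, so the
last claim is an instance of the Weyl integration formula (`weyl_integration`). The formula is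
proved without diagonalising coordinates. For the weight `exp (-½ tr H²)`, Gaussian
integration by parts along the vector field `H ↦ H ^ k` yields recursions for the expectations of
products of the traces `tr H ^ l`; along `∑ᵢ xᵢ ^ k ∂ᵢ` it yields the same recursions for power sums
under `Δ(x)² exp (-½ ∑ xᵢ²) dx` (`loopEquations_matrix`, `loopEquations_vandermonde`). Such loop
equations have only one solution up to scaling (`LoopEquations.unique`). Power sums generate the
symmetric polynomials, and Gaussian tails make the moment problem determinate, so the symmetrised
eigenvalue measures agree (`symmetrize_matrix_eq`). Removing the Gaussian factor, itself a symmetric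
function, gives the formula for Lebesgue measure.
-/


namespace HuaPickrell

open MeasureTheory ProbabilityTheory

/-! ### Loop equations and their uniqueness -/

section LoopEquations

open MvPolynomial

/-- The derivation of `ℂ[X₀, X₁, …]` sending `X_l` to `l X_{k+l-1}`. Under `X_l ↦ ∑ᵢ xᵢ ^ l` it
corresponds to the vector field `∑ᵢ xᵢ ^ k ∂ᵢ` acting on power sums. -/
noncomputable def powerSumDerivation (k : ℕ) :
    Derivation ℂ (MvPolynomial ℕ ℂ) (MvPolynomial ℕ ℂ) :=
  mkDerivation ℂ fun l => (l : MvPolynomial ℕ ℂ) * X (k + l - 1)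

/-- The loop equations for a linear functional on polynomials in the power sums `X₀, X₁, …` of `N`
variables. -/
structure LoopEquations (N : ℕ) (ℓ : MvPolynomial ℕ ℂ →ₗ[ℂ] ℂ) : Prop where
  zero : ∀ P, ℓ (X 0 * P) = N * ℓ P
  succ : ∀ k P, ℓ (X (k + 1) * P) =
    ℓ ((∑ a ∈ Finset.range k, X a * X (k - 1 - a)) * P + powerSumDerivation k P)

/-- The monomial `∏ X_l` over the entries `l` of a list. -/
noncomputable def word (L : List ℕ) : MvPolynomial ℕ ℂ := (L.map X).prod

/-- The span of the monomials whose weight, with `X_l` of weight `l`, is at most `w`. -/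
noncomputable def weightSpan (w : ℕ) : Submodule ℂ (MvPolynomial ℕ ℂ) :=
  Submodule.span ℂ {P | ∃ L : List ℕ, L.sum ≤ w ∧ P = word L}

lemma word_mem_weightSpan {L : List ℕ} {w : ℕ} (h : L.sum ≤ w) : word L ∈ weightSpan w :=
  Submodule.subset_span ⟨L, h, rfl⟩

lemma X_mul_mem_weightSpan {l w w' : ℕ} (h : l + w ≤ w') {P : MvPolynomial ℕ ℂ}
    (hP : P ∈ weightSpan w) : X l * P ∈ weightSpan w' := by
  induction hP using Submodule.span_induction with
  | mem P hP =>
    obtain ⟨L, hL, rfl⟩ := hP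
    have : X l * word L = word (l :: L) := by simp [word]
    rw [this]
    exact word_mem_weightSpan (by simp; omega)
  | zero => simp
  | add P Q _ _ hP hQ => rw [mul_add]; exact add_mem hP hQ
  | smul a P _ hP => rw [mul_smul_comm]; exact Submodule.smul_mem _ _ hP

lemma powerSumDerivation_word_mem (k : ℕ) (L : List ℕ) :
    powerSumDerivation k (word L) ∈ weightSpan (L.sum + k) := by
  induction L with
  | nil => simp [word]
  | cons l L ih =>
    have h : word (l :: L) = X l * word L := by simp [word]
    rw [h, Derivation.leibniz, smul_eq_mul, smul_eq_mul]
    refine add_mem (X_mul_mem_weightSpan (by simp; omega) ih) ?_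
    have h2 : word L * powerSumDerivation k (X l) = (l : ℂ) • (X (k + l - 1) * word L) := by
      simp [powerSumDerivation, Algebra.smul_def]; ring
    rw [h2]
    refine Submodule.smul_mem _ _ ?_
    exact X_mul_mem_weightSpan (w := L.sum) (by simp; omega)
      (word_mem_weightSpan le_rfl)

lemma LoopEquations.eq_zero_of_mem {N : ℕ} {ℓ : MvPolynomial ℕ ℂ →ₗ[ℂ] ℂ}
    (h : LoopEquations N ℓ) (h1 : ℓ 1 = 0) (w : ℕ) :
    ∀ P ∈ weightSpan w, ℓ P = 0 := by
  have hzero : ∀ L : List ℕ, L.sum = 0 → ℓ (word L) = 0 := by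
    intro L
    induction L with
    | nil => intro _; simpa [word] using h1
    | cons l L ih =>
      intro hL
      simp only [List.sum_cons, Nat.add_eq_zero_iff] at hL
      have hw : word (l :: L) = X 0 * word L := by simp [word, hL.1]
      rw [hw, h.zero, ih hL.2, mul_zero]
  induction w with
  | zero =>
    intro P hP
    induction hP using Submodule.span_induction with
    | mem P hP =>
      obtain ⟨L, hL, rfl⟩ := hP
      exact hzero L (by omega)
    | zero => simp
    | add P Q _ _ hP hQ => rw [map_add, hP, hQ, add_zero]
    | smul a P _ hP => rw [map_smul, hP, smul_zero]
  | succ w ih =>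
    intro P hP
    induction hP using Submodule.span_induction with
    | mem P hP =>
      obtain ⟨L, hL, rfl⟩ := hP
      by_cases h0 : L.sum = 0
      · exact hzero L h0
      obtain ⟨l, hl, hl0⟩ : ∃ l ∈ L, l ≠ 0 := by
        by_contra! hcon
        exact h0 (List.sum_eq_zero hcon)
      obtain ⟨k, rfl⟩ := Nat.exists_eq_succ_of_ne_zero hl0
      have hperm := List.perm_cons_erase hl
      have hw : word L = X (k + 1) * word (L.erase (k + 1)) := by
        simp only [word]
        rw [(hperm.map X).prod_eq]
        simp
      have hs : L.sum = (k + 1) + (L.erase (k + 1)).sum := by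
        rw [hperm.sum_eq]; simp
      rw [hw, h.succ]
      apply ih
      refine add_mem ?_ ?_
      · rw [Finset.sum_mul]
        refine Submodule.sum_mem _ fun a ha => ?_
        rw [mul_assoc]
        rw [Finset.mem_range] at ha
        refine X_mul_mem_weightSpan (w := k - 1 - a + (L.erase (k + 1)).sum) (by omega) ?_
        exact X_mul_mem_weightSpan le_rfl (word_mem_weightSpan le_rfl)
      · exact Submodule.span_mono (by rintro _ ⟨L', h', rfl⟩; exact ⟨L', by omega, rfl⟩)
          (powerSumDerivation_word_mem k (L.erase (k + 1)))
    | zero => simp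
    | add P Q _ _ hP hQ => rw [map_add, hP, hQ, add_zero]
    | smul a P _ hP => rw [map_smul, hP, smul_zero]

lemma exists_mem_weightSpan (P : MvPolynomial ℕ ℂ) : ∃ w, P ∈ weightSpan w := by
  have hmono : ∀ {w w' : ℕ}, w ≤ w' → weightSpan w ≤ weightSpan w' := fun h =>
    Submodule.span_mono (by rintro _ ⟨L', h', rfl⟩; exact ⟨L', h'.trans h, rfl⟩)
  induction P using MvPolynomial.induction_on with
  | C a =>
    refine ⟨0, ?_⟩
    have : (C a : MvPolynomial ℕ ℂ) = a • word [] := by simp [word, Algebra.smul_def]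
    rw [this]
    exact Submodule.smul_mem _ _ (word_mem_weightSpan (by simp))
  | add P Q hP hQ =>
    obtain ⟨w, hw⟩ := hP
    obtain ⟨w', hw'⟩ := hQ
    exact ⟨max w w', add_mem (hmono (le_max_left _ _) hw) (hmono (le_max_right _ _) hw')⟩
  | mul_X P l hP =>
    obtain ⟨w, hw⟩ := hP
    exact ⟨l + w, by rw [mul_comm]; exact X_mul_mem_weightSpan le_rfl hw⟩

/-- The loop equations determine a functional up to its value at `1`: each equation expresses
a monomial through polynomials of smaller weight. -/
lemma LoopEquations.unique {N : ℕ} {ℓ ℓ' : MvPolynomial ℕ ℂ →ₗ[ℂ] ℂ}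
    (h : LoopEquations N ℓ) (h' : LoopEquations N ℓ') (P : MvPolynomial ℕ ℂ) :
    ℓ' 1 * ℓ P = ℓ 1 * ℓ' P := by
  have hd : LoopEquations N (ℓ' 1 • ℓ - ℓ 1 • ℓ') := by
    refine ⟨fun P => ?_, fun k P => ?_⟩
    · simp [h.zero, h'.zero]; ring
    · simp [h.succ, h'.succ]
  obtain ⟨w, hw⟩ := exists_mem_weightSpan P
  have := hd.eq_zero_of_mem (by simp; ring) w P hw
  simpa [sub_eq_zero] using this

end LoopEquations

/-! ### Loop equations for the Vandermonde weight -/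

section EigenvalueSide

open MvPolynomial

/-- The Vandermonde product `∏_{i<j} (X_j - X_i)` as a polynomial. -/
noncomputable def vandermondePoly (N : ℕ) : MvPolynomial (Fin N) ℂ :=
  ∏ i : Fin N, ∏ j ∈ Finset.Ioi i, (X j - X i)

/-- The vector field `∑ᵢ xᵢ ^ k ∂ᵢ` on polynomials in `x₁, …, x_N`. -/
noncomputable def powerField (N k : ℕ) :
    Derivation ℂ (MvPolynomial (Fin N) ℂ) (MvPolynomial (Fin N) ℂ) :=
  mkDerivation ℂ fun i => X i ^ k

/-- Substitution of the power sums of `x₁, …, x_N` for the variables. -/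
noncomputable def psumHom (N : ℕ) : MvPolynomial ℕ ℂ →ₐ[ℂ] MvPolynomial (Fin N) ℂ :=
  aeval fun l => psum (Fin N) ℂ l

lemma derivation_prod_of_eigen {R A ι : Type*} [CommRing R] [CommRing A] [Algebra R A]
    (D : Derivation R A A) (s : Finset ι) (f g : ι → A) (h : ∀ i ∈ s, D (f i) = f i * g i) :
    D (∏ i ∈ s, f i) = (∏ i ∈ s, f i) * ∑ i ∈ s, g i := by
  classical
  induction s using Finset.induction_on with
  | empty => simp
  | insert a s ha ih =>
    rw [Finset.prod_insert ha, Finset.sum_insert ha, Derivation.leibniz,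
      ih fun i hi => h i (Finset.mem_insert_of_mem hi), h a (Finset.mem_insert_self _ _)]
    simp only [smul_eq_mul]
    ring

/-- The complete homogeneous sum `∑_{a+b=k-1} xᵢ ^ a xⱼ ^ b`. -/
noncomputable def mixedSum {N : ℕ} (k : ℕ) (i j : Fin N) : MvPolynomial (Fin N) ℂ :=
  ∑ a ∈ Finset.range k, X i ^ a * X j ^ (k - 1 - a)

lemma mixedSum_comm {N : ℕ} (k : ℕ) (i j : Fin N) : mixedSum k i j = mixedSum k j i := by
  unfold mixedSum
  rw [← Finset.sum_range_reflect]
  refine Finset.sum_congr rfl fun a ha => ?_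
  rw [Finset.mem_range] at ha
  rw [mul_comm]
  congr 2
  omega

lemma mixedSum_self {N : ℕ} (k : ℕ) (i : Fin N) :
    mixedSum k i i = (k : MvPolynomial (Fin N) ℂ) * X i ^ (k - 1) := by
  unfold mixedSum
  rw [Finset.sum_congr rfl (g := fun _ => (X i : MvPolynomial (Fin N) ℂ) ^ (k - 1))]
  · simp
  · intro a ha
    rw [Finset.mem_range] at ha
    rw [← pow_add]
    congr 1
    omega

lemma sum_mixedSum (N k : ℕ) : ∑ i : Fin N, ∑ j : Fin N, mixedSum k i j =
    ∑ a ∈ Finset.range k, psum (Fin N) ℂ a * psum (Fin N) ℂ (k - 1 - a) := by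
  simp only [mixedSum, psum, Finset.sum_mul_sum]
  rw [Finset.sum_comm' (t' := Finset.univ) (s' := fun _ => Finset.univ) (by simp)]
  rw [Finset.sum_congr rfl fun i _ => Finset.sum_comm, Finset.sum_comm]
  exact Finset.sum_congr rfl fun a _ => Finset.sum_comm

/-- The Vandermonde product is an eigenvector of the vector field `∑ᵢ xᵢ ^ k ∂ᵢ`: each factor is
multiplied by a divided difference. -/
lemma powerField_vandermonde (N k : ℕ) : powerField N k (vandermondePoly N) =
    vandermondePoly N * ∑ i : Fin N, ∑ j ∈ Finset.Ioi i, mixedSum k j i := by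
  unfold vandermondePoly
  refine derivation_prod_of_eigen _ _ _ _ fun i _ => ?_
  refine derivation_prod_of_eigen _ _ _ _ fun j _ => ?_
  simp only [powerField, map_sub, mkDerivation_X, mixedSum]
  rw [mul_comm, geom_sum₂_mul]

lemma sum_eq_diag_add_two_mul {N : ℕ} {A : Type*} [CommRing A] (f : Fin N → Fin N → A)
    (hf : ∀ i j, f i j = f j i) :
    ∑ i, ∑ j, f i j = ∑ i, f i i + 2 * ∑ i, ∑ j ∈ Finset.Ioi i, f j i := by
  have h1 : ∀ i, ∑ j, f i j = f i i + ∑ j ∈ Finset.Ioi i, f j i + ∑ j ∈ Finset.Iio i, f i j := by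
    intro i
    have hu : (Finset.univ : Finset (Fin N)) = insert i (Finset.Ioi i ∪ Finset.Iio i) := by
      ext j
      simp only [Finset.mem_univ, Finset.mem_insert, Finset.mem_union, Finset.mem_Ioi,
        Finset.mem_Iio, true_iff]
      rcases lt_trichotomy i j with h | h | h <;> simp [h]
    rw [hu, Finset.sum_insert (by simp), Finset.sum_union, add_assoc]
    · congr 2
      exact Finset.sum_congr rfl fun j _ => hf _ _
    · rw [Finset.disjoint_left]
      intro j h1 h2
      rw [Finset.mem_Ioi] at h1
      rw [Finset.mem_Iio] at h2
      exact absurd h1 h2.not_gt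
  have h2 : ∑ i, ∑ j ∈ Finset.Iio i, f i j = ∑ i, ∑ j ∈ Finset.Ioi i, f j i :=
    Finset.sum_comm' (by simp)
  rw [Finset.sum_congr rfl fun i _ => h1 i, Finset.sum_add_distrib, Finset.sum_add_distrib, h2]
  ring

lemma derivation_aeval_comm {σ : Type*} {A : Type*} [CommRing A] [Algebra ℂ A]
    (φ : MvPolynomial σ ℂ →ₐ[ℂ] A) (D : Derivation ℂ (MvPolynomial σ ℂ) (MvPolynomial σ ℂ))
    (D' : Derivation ℂ A A) (h : ∀ l, D' (φ (X l)) = φ (D (X l))) (P : MvPolynomial σ ℂ) :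
    D' (φ P) = φ (D P) := by
  induction P using MvPolynomial.induction_on with
  | C a =>
    have : φ (C a) = algebraMap ℂ A a := φ.commutes a
    simp [this]
  | add P Q hP hQ => simp [hP, hQ]
  | mul_X P l hP => simp [hP, h]

lemma powerField_psumHom (N k : ℕ) (P : MvPolynomial ℕ ℂ) :
    powerField N k (psumHom N P) = psumHom N (powerSumDerivation k P) := by
  refine derivation_aeval_comm _ _ _ (fun l => ?_) P
  simp only [psumHom, powerField, powerSumDerivation, mkDerivation_X, aeval_X, map_mul, map_natCast,
    psum, map_sum, Derivation.leibniz_pow, Finset.mul_sum]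
  refine Finset.sum_congr rfl fun i _ => ?_
  rcases l with _ | l
  · simp
  · simp only [nsmul_eq_mul, smul_eq_mul]
    rw [← pow_add]
    congr 2
    omega

lemma derivation_sum_apply {R A ι : Type*} [CommRing R] [CommRing A] [Algebra R A]
    (s : Finset ι) (D : ι → Derivation R A A) (a : A) : (∑ i ∈ s, D i) a = ∑ i ∈ s, D i a := by
  have := map_sum (Derivation.coeFnAddMonoidHom (R := R) (A := A) (M := A)) D s
  exact (congrFun this a).trans (Finset.sum_apply _ _ _)

lemma powerField_eq_sum (N k : ℕ) (p : MvPolynomial (Fin N) ℂ) :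
    powerField N k p = ∑ i, X i ^ k * pderiv i p := by
  have : powerField N k = ∑ i, (X i ^ k : MvPolynomial (Fin N) ℂ) • pderiv i := by
    refine MvPolynomial.derivation_ext fun j => ?_
    simp [powerField, mkDerivation_X, derivation_sum_apply, pderiv_X, Pi.single_apply]
  rw [this, derivation_sum_apply]
  simp

/-- Schwinger-Dyson equations for the eigenvalue side: integration by parts against the vector
field `∑ᵢ xᵢ ^ k ∂ᵢ`, in presence of the weight `Δ²`. -/
lemma loopEquations_vandermonde (N : ℕ) (G : MvPolynomial (Fin N) ℂ →ₗ[ℂ] ℂ)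
    (hG : ∀ i p, G (X i * p) = G (pderiv i p)) :
    LoopEquations N (G ∘ₗ LinearMap.mulLeft ℂ (vandermondePoly N ^ 2) ∘ₗ
      (psumHom N).toLinearMap) := by
  refine ⟨fun P => ?_, fun k P => ?_⟩
  · simp only [LinearMap.comp_apply, AlgHom.toLinearMap_apply, map_mul]
    have : psumHom N (X 0) = C (N : ℂ) := by simp [psumHom, psum]
    rw [this, LinearMap.mulLeft_apply, mul_left_comm, ← smul_eq_C_mul, map_smul, smul_eq_mul]
    rfl
  · simp only [LinearMap.comp_apply, AlgHom.toLinearMap_apply, LinearMap.mulLeft_apply]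
    have h1 : vandermondePoly N ^ 2 * psumHom N (X (k + 1) * P) =
        ∑ i, X i * (X i ^ k * (vandermondePoly N ^ 2 * psumHom N P)) := by
      simp only [map_mul, psumHom, aeval_X, psum, Finset.sum_mul, Finset.mul_sum]
      refine Finset.sum_congr rfl fun i _ => ?_
      ring
    rw [h1, map_sum, Finset.sum_congr rfl fun i _ => hG i _, ← map_sum]
    congr 1
    have h2 : ∀ i : Fin N, pderiv i (X i ^ k * (vandermondePoly N ^ 2 * psumHom N P)) =
        X i ^ k * pderiv i (vandermondePoly N ^ 2 * psumHom N P) +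
          mixedSum k i i * (vandermondePoly N ^ 2 * psumHom N P) := by
      intro i
      rw [Derivation.leibniz, mixedSum_self]
      simp [Derivation.leibniz_pow]
      ring
    rw [Finset.sum_congr rfl fun i _ => h2 i, Finset.sum_add_distrib, ← powerField_eq_sum,
      Derivation.leibniz, powerField_psumHom, Derivation.leibniz_pow, powerField_vandermonde,
      ← Finset.sum_mul]
    have h3 : psumHom N ((∑ a ∈ Finset.range k, X a * X (k - 1 - a)) * P +
        powerSumDerivation k P) = (∑ i : Fin N, ∑ j : Fin N, mixedSum k i j) * psumHom N P +
          psumHom N (powerSumDerivation k P) := by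
      rw [sum_mixedSum]
      simp [psumHom]
    rw [h3, sum_eq_diag_add_two_mul _ (mixedSum_comm k)]
    simp only [smul_eq_mul, nsmul_eq_mul]
    push_cast
    ring

end EigenvalueSide

/-! ### Loop equations for Hermitian matrices -/

section MatrixSide

open MvPolynomial

/-- The generic `N × N` matrix. -/
noncomputable abbrev genericMatrix (N : ℕ) :
    Matrix (Fin N) (Fin N) (MvPolynomial (Fin N × Fin N) ℂ) :=
  Matrix.mvPolynomialX (Fin N) (Fin N) ℂ

/-- Substitution of the traces `tr X ^ l` of powers of the generic matrix for the variables. -/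
noncomputable def traceHom (N : ℕ) : MvPolynomial ℕ ℂ →ₐ[ℂ] MvPolynomial (Fin N × Fin N) ℂ :=
  aeval fun l => (genericMatrix N ^ l).trace

/-- The vector field `X ↦ X ^ k` on `N × N` matrices, as a derivation. -/
noncomputable def matrixField (N k : ℕ) :
    Derivation ℂ (MvPolynomial (Fin N × Fin N) ℂ) (MvPolynomial (Fin N × Fin N) ℂ) :=
  mkDerivation ℂ fun p => (genericMatrix N ^ k) p.1 p.2

lemma derivation_matrix_mul {n R A : Type*} [Fintype n] [CommRing R] [CommRing A] [Algebra R A]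
    (D : Derivation R A A) (M M' : Matrix n n A) :
    (M * M').map D = M.map D * M' + M * M'.map D := by
  ext i j
  simp only [Matrix.map_apply, Matrix.mul_apply, Matrix.add_apply, map_sum, Derivation.leibniz,
    smul_eq_mul, Finset.sum_add_distrib]
  rw [add_comm]
  congr 1
  exact Finset.sum_congr rfl fun _ _ => mul_comm _ _

lemma derivation_matrix_pow {n R A : Type*} [Fintype n] [DecidableEq n] [CommRing R] [CommRing A]
    [Algebra R A] (D : Derivation R A A) (M : Matrix n n A) (k : ℕ) :
    (M ^ k).map D = ∑ a ∈ Finset.range k, M ^ a * M.map D * M ^ (k - 1 - a) := by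
  induction k with
  | zero =>
    ext i j
    simp [Matrix.one_apply, apply_ite D]
  | succ k ih =>
    rw [pow_succ, derivation_matrix_mul, ih, Finset.sum_range_succ, Finset.sum_mul]
    congr 1
    · refine Finset.sum_congr rfl fun a ha => ?_
      rw [Finset.mem_range] at ha
      rw [mul_assoc, ← pow_succ]
      congr 2
      omega
    · simp

lemma matrixField_eq_sum (N k : ℕ) (p : MvPolynomial (Fin N × Fin N) ℂ) :
    matrixField N k p = ∑ i, ∑ j, (genericMatrix N ^ k) j i * pderiv (j, i) p := by
  have : matrixField N k = ∑ q : Fin N × Fin N,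
      ((genericMatrix N ^ k) q.1 q.2 : MvPolynomial (Fin N × Fin N) ℂ) • pderiv q := by
    refine MvPolynomial.derivation_ext fun j => ?_
    simp [matrixField, mkDerivation_X, derivation_sum_apply, pderiv_X, Pi.single_apply]
  rw [this, derivation_sum_apply, Fintype.sum_prod_type, Finset.sum_comm]
  simp

lemma matrixField_traceHom (N k : ℕ) (P : MvPolynomial ℕ ℂ) :
    matrixField N k (traceHom N P) = traceHom N (powerSumDerivation k P) := by
  refine derivation_aeval_comm _ _ _ (fun l => ?_) P
  simp only [traceHom, powerSumDerivation, mkDerivation_X, aeval_X, map_mul, map_natCast]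
  have h1 : (genericMatrix N).map (matrixField N k) = genericMatrix N ^ k := by
    ext i j : 2
    simp [matrixField, Matrix.mvPolynomialX, mkDerivation_X]
  have h2 : matrixField N k (genericMatrix N ^ l).trace =
      ((genericMatrix N ^ l).map (matrixField N k)).trace := by
    simp [Matrix.trace]
  rw [h2, derivation_matrix_pow, h1, Matrix.trace_sum, Finset.sum_congr rfl
    (g := fun _ => (genericMatrix N ^ (k + l - 1)).trace)]
  · simp
  · intro a ha
    rw [Finset.mem_range] at ha
    rw [← pow_add, ← pow_add]
    congr 2
    omega

lemma pderiv_genericMatrix_pow (N k : ℕ) (i j : Fin N) :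
    pderiv (j, i) ((genericMatrix N ^ k) j i) =
      ∑ a ∈ Finset.range k, (genericMatrix N ^ a) j j * (genericMatrix N ^ (k - 1 - a)) i i := by
  have h1 : (genericMatrix N).map (pderiv (j, i)) = Matrix.single j i 1 := by
    ext i' j' : 2
    simp only [Matrix.map_apply, Matrix.mvPolynomialX_apply, pderiv_X, Pi.single_apply,
      Matrix.single_apply, Prod.mk.injEq]
    congr 1
    simp [eq_comm]
  have h2 : pderiv (j, i) ((genericMatrix N ^ k) j i) =
      ((genericMatrix N ^ k).map (pderiv (j, i))) j i := rfl
  rw [h2, derivation_matrix_pow, h1, Matrix.sum_apply]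
  refine Finset.sum_congr rfl fun a _ => ?_
  simp [Matrix.mul_apply, Matrix.single_apply, Finset.sum_ite_eq, ite_and]

/-- Schwinger-Dyson equations for the matrix side: integration by parts against the vector field
`H ↦ H ^ k`. -/
lemma loopEquations_matrix (N : ℕ) (G : MvPolynomial (Fin N × Fin N) ℂ →ₗ[ℂ] ℂ)
    (hG : ∀ i j p, G (X (i, j) * p) = G (pderiv (j, i) p)) :
    LoopEquations N (G ∘ₗ (traceHom N).toLinearMap) := by
  refine ⟨fun P => ?_, fun k P => ?_⟩
  · simp only [LinearMap.comp_apply, AlgHom.toLinearMap_apply, map_mul]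
    have : traceHom N (X 0) = C (N : ℂ) := by simp [traceHom]
    rw [this, ← smul_eq_C_mul, map_smul, smul_eq_mul]
  · simp only [LinearMap.comp_apply, AlgHom.toLinearMap_apply]
    have h1 : traceHom N (X (k + 1) * P) =
        ∑ i, ∑ j, X (i, j) * ((genericMatrix N ^ k) j i * traceHom N P) := by
      rw [map_mul]
      simp only [traceHom, aeval_X, Matrix.trace, pow_succ' (genericMatrix N), Matrix.diag_apply,
        Matrix.mul_apply, Finset.sum_mul, Matrix.mvPolynomialX_apply, mul_assoc]
    simp only [h1, map_sum, hG]
    simp only [← map_sum]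
    congr 1
    have h2 : ∀ i j : Fin N, pderiv (j, i) ((genericMatrix N ^ k) j i * traceHom N P) =
        (genericMatrix N ^ k) j i * pderiv (j, i) (traceHom N P) +
        (∑ a ∈ Finset.range k, (genericMatrix N ^ a) j j * (genericMatrix N ^ (k - 1 - a)) i i) *
          traceHom N P := by
      intro i j
      rw [Derivation.leibniz, pderiv_genericMatrix_pow, smul_eq_mul, smul_eq_mul]
      ring
    simp only [h2, Finset.sum_add_distrib, ← matrixField_eq_sum, matrixField_traceHom,
      ← Finset.sum_mul]
    rw [map_add, map_mul, map_sum, add_comm]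
    congr 2
    have h3 : ∀ a b, traceHom N (X a * X b) =
        ∑ i, ∑ j, (genericMatrix N ^ a) j j * (genericMatrix N ^ b) i i := by
      intro a b
      simp only [map_mul, traceHom, aeval_X, Matrix.trace, Finset.sum_mul_sum, Matrix.diag_apply]
      exact Finset.sum_comm
    simp only [h3]
    rw [Finset.sum_congr rfl fun i _ => Finset.sum_comm, Finset.sum_comm]

/-- The algebraic core of the Weyl integration formula: two functionals on polynomials that obey
Gaussian integration by parts agree, up to normalisation, on power sums. -/
lemma trace_functional_eq (N : ℕ) (G : MvPolynomial (Fin N × Fin N) ℂ →ₗ[ℂ] ℂ)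
    (hG : ∀ i j p, G (X (i, j) * p) = G (pderiv (j, i) p))
    (G' : MvPolynomial (Fin N) ℂ →ₗ[ℂ] ℂ) (hG' : ∀ i p, G' (X i * p) = G' (pderiv i p))
    (P : MvPolynomial ℕ ℂ) :
    G' (vandermondePoly N ^ 2) * G (traceHom N P) =
      G 1 * G' (vandermondePoly N ^ 2 * psumHom N P) := by
  have := (loopEquations_matrix N G hG).unique (loopEquations_vandermonde N G' hG') P
  simpa using this

end MatrixSide

/-! ### Power sums and Gaussian integration by parts -/

section GaussianFunctionals

open MvPolynomial

lemma esymm_mem_range_psumHom (N k : ℕ) : esymm (Fin N) ℂ k ∈ (psumHom N).range := by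
  induction k using Nat.strong_induction_on with
  | _ k ih =>
    rcases Nat.eq_zero_or_pos k with rfl | hk
    · rw [esymm_zero]; exact one_mem _
    have hps : ∀ l, psum (Fin N) ℂ l ∈ (psumHom N).range := fun l => ⟨X l, by simp [psumHom]⟩
    have h := mul_esymm_eq_sum (Fin N) ℂ k
    have hmem : (k : MvPolynomial (Fin N) ℂ) * esymm (Fin N) ℂ k ∈ (psumHom N).range := by
      rw [h]
      refine mul_mem (pow_mem (neg_mem (one_mem _)) _) (sum_mem fun a ha => ?_)
      rw [Finset.mem_filter] at ha
      exact mul_mem (mul_mem (pow_mem (neg_mem (one_mem _)) _) (ih _ ha.2)) (hps _)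
    have h2 := Subalgebra.smul_mem _ hmem ((k : ℂ)⁻¹)
    have hk' : (k : ℂ) ≠ 0 := by exact_mod_cast hk.ne'
    have h3 : ((k : ℂ)⁻¹) • ((k : MvPolynomial (Fin N) ℂ) * esymm (Fin N) ℂ k) =
        esymm (Fin N) ℂ k := by
      have : (k : MvPolynomial (Fin N) ℂ) = C (k : ℂ) := by simp
      rw [this, ← smul_eq_C_mul, smul_smul, inv_mul_cancel₀ hk', one_smul]
    rwa [h3] at h2

/-- Over `ℂ` the power sums generate the algebra of symmetric polynomials, by Newton's
identities. -/
lemma exists_psumHom_eq {N : ℕ} {S : MvPolynomial (Fin N) ℂ} (hS : S.IsSymmetric) :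
    ∃ P, psumHom N P = S := by
  obtain ⟨q, hq⟩ := esymmAlgHom_surjective (R := ℂ) (σ := Fin N) (n := N) (by simp)
    ⟨S, (mem_symmetricSubalgebra S).2 hS⟩
  have hmem : ∀ q : MvPolynomial (Fin N) ℂ,
      aeval (fun i : Fin N => esymm (Fin N) ℂ (i + 1)) q ∈ (psumHom N).range := by
    intro q
    induction q using MvPolynomial.induction_on with
    | C a => rw [aeval_C]; exact algebraMap_mem _ a
    | add P Q hP hQ => rw [map_add]; exact add_mem hP hQ
    | mul_X P i hP =>
      rw [map_mul, aeval_X]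
      exact mul_mem hP (esymm_mem_range_psumHom N _)
  have hq' : aeval (fun i : Fin N => esymm (Fin N) ℂ (i + 1)) q = S := by
    rw [← esymmAlgHom_apply, hq]
  exact hq' ▸ hmem q

lemma exp_mul_sub_sq_le (a b r : ℝ) (hb : 0 < b) (hr : 0 ≤ r) (t : ℝ) (ht : 0 ≤ t) :
    Real.exp (a * t) * Real.exp (-(b * t ^ 2)) ≤
      Real.exp ((a + r) ^ 2 / (4 * b)) * (1 + t) ^ (-r) := by
  rw [Real.rpow_neg (by linarith), ← div_eq_mul_inv, le_div_iff₀ (by positivity), ← Real.exp_add]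
  have h1 : (1 + t) ^ r ≤ Real.exp (r * t) := by
    rw [mul_comm, Real.exp_mul]
    exact Real.rpow_le_rpow (by linarith) (by linarith [Real.add_one_le_exp t]) hr
  calc _ ≤ Real.exp (a * t + -(b * t ^ 2)) * Real.exp (r * t) := by gcongr
    _ = Real.exp (a * t + -(b * t ^ 2) + r * t) := (Real.exp_add _ _).symm
    _ ≤ _ := by
      apply Real.exp_le_exp.2
      rw [le_div_iff₀ (by positivity)]
      nlinarith [sq_nonneg (2 * b * t - (a + r))]

section Gaussian

variable {V : Type*} [NormedAddCommGroup V] [NormedSpace ℝ V]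

variable {ι : Type*} (ℓ : ι → V →L[ℝ] ℂ)

/-- The value at `x` of a polynomial in the coordinate functions `ℓ i`. -/
noncomputable def evalCoords (p : MvPolynomial ι ℂ) (x : V) : ℂ :=
  eval (fun i => ℓ i x) p

lemma continuous_evalCoords (p : MvPolynomial ι ℂ) : Continuous (evalCoords ℓ p) := by
  unfold evalCoords
  exact (MvPolynomial.continuous_eval p).comp (by fun_prop)

lemma exists_evalCoords_bound (p : MvPolynomial ι ℂ) :
    ∃ C a : ℝ, 0 ≤ a ∧ 0 ≤ C ∧ ∀ x, ‖evalCoords ℓ p x‖ ≤ C * Real.exp (a * ‖x‖) := by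
  induction p using MvPolynomial.induction_on with
  | C z => exact ⟨‖z‖, 0, le_rfl, norm_nonneg _, fun x => by simp [evalCoords]⟩
  | add p q hp hq =>
    obtain ⟨C, a, ha, hC, h⟩ := hp
    obtain ⟨C', a', ha', hC', h'⟩ := hq
    refine ⟨C + C', max a a', le_max_of_le_left ha, by positivity, fun x => ?_⟩
    have : evalCoords ℓ (p + q) x = evalCoords ℓ p x + evalCoords ℓ q x := by simp [evalCoords]
    rw [this, add_mul]
    refine (norm_add_le _ _).trans (add_le_add ((h x).trans ?_) ((h' x).trans ?_))
    · gcongr; exact le_max_left _ _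
    · gcongr; exact le_max_right _ _
  | mul_X p i hp =>
    obtain ⟨C, a, ha, hC, h⟩ := hp
    refine ⟨C * ‖ℓ i‖, a + 1, by positivity, by positivity, fun x => ?_⟩
    have : evalCoords ℓ (p * X i) x = evalCoords ℓ p x * ℓ i x := by simp [evalCoords]
    rw [this, norm_mul, add_mul, one_mul, Real.exp_add]
    calc _ ≤ (C * Real.exp (a * ‖x‖)) * (‖ℓ i‖ * Real.exp ‖x‖) := by
          gcongr
          · exact h x
          · refine ((ℓ i).le_opNorm x).trans ?_
            gcongr
            linarith [Real.add_one_le_exp ‖x‖]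
      _ = _ := by ring

variable [Fintype ι]

/-- The quadratic form `½ ∑ᵢ |ℓᵢ(x)|²`. -/
noncomputable def quadForm (x : V) : ℝ := (1 / 2) * ∑ i, ‖ℓ i x‖ ^ 2

lemma continuous_quadForm : Continuous (quadForm ℓ) := by
  unfold quadForm; fun_prop

lemma hasLineDerivAt_evalCoords (p : MvPolynomial ι ℂ) (x v : V) :
    HasLineDerivAt ℝ (evalCoords ℓ p) (∑ i, ℓ i v * evalCoords ℓ (pderiv i p) x) x v := by
  classical
  induction p using MvPolynomial.induction_on with
  | C z =>
    have : evalCoords ℓ (C z) = fun _ => z := by ext; simp [evalCoords]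
    rw [this]
    simpa [HasLineDerivAt, evalCoords] using hasDerivAt_const (0 : ℝ) z
  | add p q hp hq =>
    have h := HasDerivAt.add hp hq
    refine HasDerivAt.congr_deriv (f := fun t => evalCoords ℓ (p + q) (x + t • v)) ?_ ?_
      (f' := (∑ i, ℓ i v * evalCoords ℓ (pderiv i p) x) +
        (∑ i, ℓ i v * evalCoords ℓ (pderiv i q) x))
    · convert h using 1
      ext t
      simp [evalCoords]
    · simp [evalCoords, mul_add, Finset.sum_add_distrib]
  | mul_X p i hp =>
    have hℓ : HasDerivAt (fun t : ℝ => ℓ i (x + t • v)) (ℓ i v) 0 := by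
      have h1 : HasDerivAt (fun t : ℝ => x + t • v) v 0 := by
        simpa using ((hasDerivAt_id (0 : ℝ)).smul_const v).const_add x
      exact ((ℓ i).hasFDerivAt (x := x + (0 : ℝ) • v)).comp_hasDerivAt 0 h1
    have h := HasDerivAt.mul hp hℓ
    refine HasDerivAt.congr_deriv (f := fun t => evalCoords ℓ (p * X i) (x + t • v))
      (f' := (∑ j, ℓ j v * evalCoords ℓ (pderiv j p) x) * ℓ i (x + (0 : ℝ) • v) +
        evalCoords ℓ p (x + (0 : ℝ) • v) * ℓ i v) ?_ ?_
    · have he : (fun t : ℝ => evalCoords ℓ (p * X i) (x + t • v)) =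
          (fun t : ℝ => evalCoords ℓ p (x + t • v)) * fun t : ℝ => ℓ i (x + t • v) := by
        funext t
        simp only [evalCoords, map_mul, eval_X, Pi.mul_apply]
      rw [he]
      exact h
    · simp [evalCoords, mul_add, Finset.sum_add_distrib, pderiv_X, Pi.single_apply,
        Finset.sum_mul, apply_ite]
      rw [add_comm]
      congr 1
      · ring
      · exact Finset.sum_congr rfl fun j _ => by ring

lemma hasLineDerivAt_quadForm (x v : V) :
    HasLineDerivAt ℝ (quadForm ℓ) (∑ i, (ℓ i v * star (ℓ i x)).re) x v := by
  have h : ∀ i, HasDerivAt (fun t : ℝ => ‖ℓ i (x + t • v)‖ ^ 2)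
      (2 * (ℓ i v * star (ℓ i x)).re) 0 := by
    intro i
    have he : (fun t : ℝ => ‖ℓ i (x + t • v)‖ ^ 2) = fun t : ℝ =>
        ‖ℓ i x‖ ^ 2 + t * (2 * (ℓ i v * star (ℓ i x)).re) + t ^ 2 * ‖ℓ i v‖ ^ 2 := by
      ext t
      rw [map_add, map_smul, ← Complex.normSq_eq_norm_sq, ← Complex.normSq_eq_norm_sq,
        ← Complex.normSq_eq_norm_sq]
      simp [Complex.normSq_apply]
      ring
    rw [he]
    have h1 := ((hasDerivAt_id (0 : ℝ)).mul_const (2 * (ℓ i v * star (ℓ i x)).re)).const_add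
      (‖ℓ i x‖ ^ 2)
    have h2 := ((hasDerivAt_pow 2 (0 : ℝ)).mul_const (‖ℓ i v‖ ^ 2))
    have := h1.fun_add h2
    simpa using this
  have := (HasDerivAt.fun_sum (u := Finset.univ) fun i _ => h i).const_mul (1 / 2 : ℝ)
  unfold HasLineDerivAt quadForm
  refine this.congr_deriv ?_
  rw [← Finset.mul_sum]
  ring

variable [FiniteDimensional ℝ V] [MeasurableSpace V] [BorelSpace V]

/-- A function of at most exponential growth is integrable against a Gaussian weight. -/
lemma integrable_mul_exp_neg {μ : Measure V} [μ.IsAddHaarMeasure] {Q : V → ℝ} {b : ℝ}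
    (hb : 0 < b) (hQ : ∀ x, b * ‖x‖ ^ 2 ≤ Q x) (hQc : Continuous Q) {f : V → ℂ}
    (hf : AEStronglyMeasurable f μ) {C a : ℝ} (hfb : ∀ x, ‖f x‖ ≤ C * Real.exp (a * ‖x‖)) :
    Integrable (fun x => f x * (Real.exp (-Q x) : ℂ)) μ := by
  let r : ℝ := Module.finrank ℝ V + 1
  have hC : 0 ≤ C := by
    have h0 := (norm_nonneg (f 0)).trans (hfb 0)
    exact nonneg_of_mul_nonneg_left h0 (Real.exp_pos _)
  have hint := ((integrable_one_add_norm (μ := μ) (E := V) (r := r) (by simp [r])).const_mul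
    (C * Real.exp ((a + r) ^ 2 / (4 * b))))
  refine hint.mono' ?_ (Filter.Eventually.of_forall fun x => ?_)
  · refine hf.mul (Continuous.aestronglyMeasurable ?_)
    fun_prop
  · rw [norm_mul, Complex.norm_real, Real.norm_eq_abs, Real.abs_exp]
    calc ‖f x‖ * Real.exp (-Q x) ≤ C * Real.exp (a * ‖x‖) * Real.exp (-(b * ‖x‖ ^ 2)) := by
          gcongr
          · exact hfb x
          · exact hQ x
      _ = C * (Real.exp (a * ‖x‖) * Real.exp (-(b * ‖x‖ ^ 2))) := by ring
      _ ≤ C * (Real.exp ((a + r) ^ 2 / (4 * b)) * (1 + ‖x‖) ^ (-r)) := by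
          refine mul_le_mul_of_nonneg_left ?_ hC
          exact exp_mul_sub_sq_le a b r hb (by positivity) ‖x‖ (norm_nonneg x)
      _ = _ := by ring

variable (μ : Measure V) [μ.IsAddHaarMeasure] {b : ℝ}

lemma integrable_evalCoords (hb : 0 < b) (hQ : ∀ x, b * ‖x‖ ^ 2 ≤ quadForm ℓ x)
    (p : MvPolynomial ι ℂ) :
    Integrable (fun x => evalCoords ℓ p x * (Real.exp (-quadForm ℓ x) : ℂ)) μ := by
  obtain ⟨C, a, -, -, h⟩ := exists_evalCoords_bound ℓ p
  exact integrable_mul_exp_neg hb hQ (continuous_quadForm ℓ)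
    (continuous_evalCoords ℓ p).aestronglyMeasurable h

/-- The Gaussian functional `p ↦ ∫ p(ℓ(x)) exp(-½ ∑ᵢ |ℓᵢ(x)|²) dμ(x)` on polynomials. -/
noncomputable def gaussianFunctional (hb : 0 < b) (hQ : ∀ x, b * ‖x‖ ^ 2 ≤ quadForm ℓ x) :
    MvPolynomial ι ℂ →ₗ[ℂ] ℂ where
  toFun p := ∫ x, evalCoords ℓ p x * (Real.exp (-quadForm ℓ x) : ℂ) ∂μ
  map_add' p q := by
    rw [← integral_add (integrable_evalCoords ℓ μ hb hQ p) (integrable_evalCoords ℓ μ hb hQ q)]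
    simp [evalCoords, add_mul]
  map_smul' z p := by
    rw [RingHom.id_apply, smul_eq_mul, ← integral_const_mul]
    simp [evalCoords, mul_assoc]

/-- Gaussian integration by parts in the real direction `v`. -/
lemma gaussianFunctional_lineDeriv (hb : 0 < b) (hQ : ∀ x, b * ‖x‖ ^ 2 ≤ quadForm ℓ x)
    (τ : ι → ι) (hτ : Function.Involutive τ) (hℓ : ∀ i x, ℓ (τ i) x = star (ℓ i x)) (v : V)
    (p : MvPolynomial ι ℂ) :
    ∑ i, ℓ i v * gaussianFunctional ℓ μ hb hQ (X (τ i) * p) =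
      ∑ i, ℓ i v * gaussianFunctional ℓ μ hb hQ (pderiv i p) := by
  have hB : ∀ x, ((∑ i, (ℓ i v * star (ℓ i x)).re : ℝ) : ℂ) = ∑ i, ℓ i v * ℓ (τ i) x := by
    intro x
    have h2 : ∑ i, ℓ i v * ℓ (τ i) x = ∑ i, star (ℓ i v * ℓ (τ i) x) := by
      rw [← Equiv.sum_comp hτ.toPerm]
      refine Finset.sum_congr rfl fun i _ => ?_
      rw [Function.Involutive.coe_toPerm, hℓ, hℓ, hℓ]
      simp
    have h1 : ∀ i, (((ℓ i v * star (ℓ i x)).re : ℝ) : ℂ) =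
        (ℓ i v * ℓ (τ i) x + star (ℓ i v * ℓ (τ i) x)) / 2 := by
      intro i
      rw [hℓ, Complex.re_eq_add_conj]
      simp
    push_cast
    rw [Finset.sum_congr rfl fun i _ => h1 i, ← Finset.sum_div, Finset.sum_add_distrib, ← h2]
    ring
  set g : V → ℂ := fun x => (Real.exp (-quadForm ℓ x) : ℂ) with hg
  have hgd : ∀ x, HasLineDerivAt ℝ g (-(∑ i, ℓ i v * ℓ (τ i) x) * g x) x v := by
    intro x
    have h1 : HasDerivAt (fun t : ℝ => Real.exp (-quadForm ℓ (x + t • v)))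
        (Real.exp (-quadForm ℓ (x + (0 : ℝ) • v)) * (-(∑ i, (ℓ i v * star (ℓ i x)).re))) 0 :=
      (HasDerivAt.neg (hasLineDerivAt_quadForm ℓ x v)).exp
    have h2 := h1.ofReal_comp
    refine HasDerivAt.congr_deriv h2 ?_
    rw [hg, ← hB]
    push_cast
    simp
    ring
  have hpoly : ∀ c : ι → ℂ, ∀ q : ι → MvPolynomial ι ℂ,
      (∫ x, (∑ i, c i * evalCoords ℓ (q i) x) * g x ∂μ) =
        ∑ i, c i * gaussianFunctional ℓ μ hb hQ (q i) := by
    intro c q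
    have h : ∀ x, (∑ i, c i * evalCoords ℓ (q i) x) * g x =
        evalCoords ℓ (∑ i, c i • q i) x * g x := by
      intro x; simp [evalCoords]
    simp only [h]
    have : gaussianFunctional ℓ μ hb hQ (∑ i, c i • q i) =
        ∑ i, c i * gaussianFunctional ℓ μ hb hQ (q i) := by
      simp
    rw [← this]
    rfl
  have hint : ∀ c : ι → ℂ, ∀ q : ι → MvPolynomial ι ℂ,
      Integrable (fun x => (∑ i, c i * evalCoords ℓ (q i) x) * g x) μ := by
    intro c q
    have := integrable_evalCoords ℓ μ hb hQ (∑ i, c i • q i)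
    refine this.congr (Filter.Eventually.of_forall fun x => ?_)
    simp [evalCoords, hg]
  have hX : ∀ x, evalCoords ℓ p x * (-(∑ i, ℓ i v * ℓ (τ i) x) * g x) =
      -((∑ i, ℓ i v * evalCoords ℓ (X (τ i) * p) x) * g x) := by
    intro x
    have : ∑ i, ℓ i v * evalCoords ℓ (X (τ i) * p) x =
        (∑ i, ℓ i v * ℓ (τ i) x) * evalCoords ℓ p x := by
      rw [Finset.sum_mul]
      exact Finset.sum_congr rfl fun i _ => by simp [evalCoords, mul_assoc]
    rw [this]; ring
  have key := integral_bilinear_hasLineDerivAt_right_eq_neg_left_of_integrable (μ := μ)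
    (f := evalCoords ℓ p) (g := g) (v := v) (B := ContinuousLinearMap.mul ℝ ℂ)
    (f' := fun x => ∑ i, ℓ i v * evalCoords ℓ (pderiv i p) x)
    (g' := fun x => -(∑ i, ℓ i v * ℓ (τ i) x) * g x)
    (hint _ _) (by
      simp only [ContinuousLinearMap.mul_apply', hX]
      exact (hint _ _).neg) (integrable_evalCoords ℓ μ hb hQ p)
    (fun x _ => hasLineDerivAt_evalCoords ℓ p x v) (fun x _ => hgd x)
  simp only [ContinuousLinearMap.mul_apply', hX, integral_neg, hpoly, neg_inj] at key
  exact key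

/-- Gaussian integration by parts for a single coordinate. The directions `v` are real, but both
sides of `gaussianFunctional_lineDeriv` are `ℂ`-linear in `(ℓᵢ(v))ᵢ`. -/
lemma gaussianFunctional_X_mul (hb : 0 < b) (hQ : ∀ x, b * ‖x‖ ^ 2 ≤ quadForm ℓ x)
    (τ : ι → ι) (hτ : Function.Involutive τ) (hℓ : ∀ i x, ℓ (τ i) x = star (ℓ i x))
    [DecidableEq ι]
    (hspan : ∀ i, ∃ u v : V, ∀ j, ℓ j u + Complex.I * ℓ j v = if i = j then 1 else 0)
    (i : ι) (p : MvPolynomial ι ℂ) :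
    gaussianFunctional ℓ μ hb hQ (X (τ i) * p) = gaussianFunctional ℓ μ hb hQ (pderiv i p) := by
  obtain ⟨u, v, huv⟩ := hspan i
  have hu := gaussianFunctional_lineDeriv ℓ μ hb hQ τ hτ hℓ u p
  have hv := gaussianFunctional_lineDeriv ℓ μ hb hQ τ hτ hℓ v p
  have h : ∀ F : ι → ℂ, F i = ∑ j, ℓ j u * F j + Complex.I * ∑ j, ℓ j v * F j := by
    intro F
    rw [Finset.mul_sum, ← Finset.sum_add_distrib]
    have : ∀ j, ℓ j u * F j + Complex.I * (ℓ j v * F j) = if i = j then F j else 0 := by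
      intro j
      rw [← mul_assoc, ← add_mul, huv]
      split_ifs <;> simp
    simp [this]
  rw [h fun j => gaussianFunctional ℓ μ hb hQ (X (τ j) * p),
    h fun j => gaussianFunctional ℓ μ hb hQ (pderiv j p), hu, hv]

end Gaussian

end GaussianFunctionals

/-! ### Moment determinacy and ordered eigenvalues -/

section MomentsAndEigenvalues

open MvPolynomial

section Moments

variable {V : Type*} [NormedAddCommGroup V] [NormedSpace ℝ V] [MeasurableSpace V] [BorelSpace V]

/-- With exponential moments in the direction `L`, the characteristic function at `L` is the sum of
its moment series. -/
lemma hasSum_charFunDual {μ : Measure V} (L : StrongDual ℝ V)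
    (h : Integrable (fun v => Real.exp |L v|) μ) :
    HasSum (fun n : ℕ => (∫ v, (L v : ℂ) ^ n ∂μ) * (Complex.I ^ n / (n.factorial : ℂ)))
      (charFunDual μ L) := by
  have hs : ∀ v, HasSum (fun n : ℕ => |L v| ^ n / (n.factorial : ℝ)) (Real.exp |L v|) := by
    intro v
    rw [Real.exp_eq_exp_ℝ]
    exact NormedSpace.expSeries_div_hasSum_exp _
  have hc : ∀ v, HasSum (fun n : ℕ => (L v : ℂ) ^ n * (Complex.I ^ n / (n.factorial : ℂ)))
      (Complex.exp (L v * Complex.I)) := by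
    intro v
    rw [Complex.exp_eq_exp_ℂ]
    have := NormedSpace.expSeries_div_hasSum_exp ((L v : ℂ) * Complex.I)
    simpa [mul_pow, mul_div_assoc] using this
  have hF := hasSum_integral_of_dominated_convergence (μ := μ)
    (F := fun (n : ℕ) v => (L v : ℂ) ^ n * (Complex.I ^ n / (n.factorial : ℂ)))
    (f := fun v => Complex.exp (L v * Complex.I))
    (bound := fun (n : ℕ) v => |L v| ^ n / (n.factorial : ℝ))
    (fun n => by
      have : Measurable L := L.continuous.measurable
      exact (by fun_prop : Measurable fun v => (L v : ℂ) ^ n *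
        (Complex.I ^ n / (n.factorial : ℂ))).aestronglyMeasurable)
    (fun n => Filter.Eventually.of_forall fun v => by
      simp [norm_pow, div_eq_mul_inv])
    (Filter.Eventually.of_forall fun v => (hs v).summable)
    (by simpa only [(hs _).tsum_eq] using h)
    (Filter.Eventually.of_forall fun v => hc v)
  simp only [integral_mul_const] at hF
  exact hF

/-- Finite measures with exponential moments are determined by the moments of their
one-dimensional marginals. -/
lemma measure_ext_of_moments [CompleteSpace V] [SecondCountableTopology V] {μ ν : Measure V}
    [IsFiniteMeasure μ] [IsFiniteMeasure ν]
    (hμ : ∀ L : StrongDual ℝ V, Integrable (fun v => Real.exp |L v|) μ)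
    (hν : ∀ L : StrongDual ℝ V, Integrable (fun v => Real.exp |L v|) ν)
    (h : ∀ (L : StrongDual ℝ V) (n : ℕ), ∫ v, (L v : ℂ) ^ n ∂μ = ∫ v, (L v : ℂ) ^ n ∂ν) :
    μ = ν := by
  refine Measure.ext_of_charFunDual (funext fun L => ?_)
  refine (hasSum_charFunDual L (hμ L)).unique ?_
  simp only [h]
  exact hasSum_charFunDual L (hν L)

end Moments

section Eigenvalues

/-- The eigenvalues of a Hermitian matrix in decreasing order. -/
noncomputable def orderedEigenvalues {N : ℕ} (H : HermitianMatrix (Fin N)) : Fin N → ℝ :=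
  fun i => H.2.eigenvalues₀ (Fin.cast (Fintype.card_fin N).symm i)

variable {N : ℕ} (H : HermitianMatrix (Fin N))

lemma antitone_orderedEigenvalues : Antitone (orderedEigenvalues H) :=
  fun _ _ h => H.2.eigenvalues₀_antitone h

lemma exists_orderedEigenvalues_eq :
    ∃ e : Equiv.Perm (Fin N), orderedEigenvalues H = H.2.eigenvalues ∘ e := by
  refine ⟨(finCongr (Fintype.card_fin N).symm).trans
    (Fintype.equivOfCardEq (Fintype.card_fin _)), ?_⟩
  ext i
  simp [orderedEigenvalues, Matrix.IsHermitian.eigenvalues]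

/-- The spectral theorem as an algebra automorphism `φ` preserving trace and determinant; the
eigenvalues come in some order `x`, of which `orderedEigenvalues` is a rearrangement. -/
lemma exists_conj_eq : ∃ (φ : Matrix (Fin N) (Fin N) ℂ ≃ₐ[ℂ] Matrix (Fin N) (Fin N) ℂ)
    (x : Fin N → ℝ) (e : Equiv.Perm (Fin N)),
    (∀ M, (φ M).trace = M.trace) ∧ (∀ M, (φ M).det = M.det) ∧
      H.1 = φ (Matrix.diagonal fun i => (x i : ℂ)) ∧ orderedEigenvalues H = x ∘ e := by
  obtain ⟨e, he⟩ := exists_orderedEigenvalues_eq H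
  refine ⟨(Unitary.conjStarAlgAut ℂ _ H.2.eigenvectorUnitary).toAlgEquiv, H.2.eigenvalues, e,
    fun M => ?_, fun M => ?_, H.2.spectral_theorem, he⟩
  · change (Unitary.conjStarAlgAut ℂ _ H.2.eigenvectorUnitary M).trace = _
    rw [Unitary.conjStarAlgAut_apply, Matrix.trace_mul_comm, ← mul_assoc]
    simp
  · change (Unitary.conjStarAlgAut ℂ _ H.2.eigenvectorUnitary M).det = _
    rw [Unitary.conjStarAlgAut_apply, Matrix.det_mul_comm, ← mul_assoc]
    simp

lemma trace_pow_eq_sum (l : ℕ) :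
    (H.1 ^ l).trace = ∑ i, (orderedEigenvalues H i : ℂ) ^ l := by
  obtain ⟨φ, x, e, h1, -, h3, he⟩ := exists_conj_eq H
  rw [he, h3, ← map_pow, h1, Matrix.diagonal_pow, Matrix.trace_diagonal]
  exact (Equiv.sum_comp e fun i => (x i : ℂ) ^ l).symm

lemma det_one_add_sq :
    (1 + H.1 ^ 2).det = ∏ i, (1 + (orderedEigenvalues H i : ℂ) ^ 2) := by
  obtain ⟨φ, x, e, -, h2, h3, he⟩ := exists_conj_eq H
  have : 1 + H.1 ^ 2 = φ (Matrix.diagonal fun i => 1 + (x i : ℂ) ^ 2) := by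
    rw [h3, ← map_pow, ← map_one φ, ← map_add, Matrix.diagonal_pow, ← Matrix.diagonal_one,
      Matrix.diagonal_add]
    rfl
  rw [this, he, h2, Matrix.det_diagonal]
  exact (Equiv.prod_comp e fun i => (1 + (x i : ℂ) ^ 2)).symm

lemma det_sub_eq_prod (q : ℂ) :
    (Matrix.scalar (Fin N) q - H.1).det = ∏ i, (q - (orderedEigenvalues H i : ℂ)) := by
  obtain ⟨e, he⟩ := exists_orderedEigenvalues_eq H
  rw [← Matrix.eval_charpoly, H.2.charpoly_eq, Polynomial.eval_prod, he]
  simp only [Polynomial.eval_sub, Polynomial.eval_X, Polynomial.eval_C]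
  exact (Equiv.prod_comp e fun i => (q - (H.2.eigenvalues i : ℂ))).symm

/-- The values of the monic polynomial with roots `x` at rational points. -/
noncomputable def rootProducts {N : ℕ} (x : Fin N → ℝ) : ℚ → ℝ := fun q => ∏ i, ((q : ℝ) - x i)

lemma continuous_rootProducts : Continuous (rootProducts : (Fin N → ℝ) → ℚ → ℝ) := by
  unfold rootProducts; fun_prop

/-- A point of the Weyl chamber is determined by the values of its monic polynomial at the
rationals. -/
lemma injOn_rootProducts : Set.InjOn (rootProducts : (Fin N → ℝ) → ℚ → ℝ) (weylChamber N) := by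
  intro x hx y hy hxy
  have hpoly : (∏ i, (Polynomial.X - Polynomial.C (x i))) =
      ∏ i, (Polynomial.X - Polynomial.C (y i)) := by
    refine Polynomial.eq_of_infinite_eval_eq _ _ ((Set.infinite_range_of_injective
      (Rat.cast_injective (α := ℝ))).mono ?_)
    rintro _ ⟨q, rfl⟩
    simpa [Polynomial.eval_prod, rootProducts] using congrFun hxy q
  have hroots : Multiset.map x Finset.univ.val = Multiset.map y Finset.univ.val := by
    have h := congrArg Polynomial.roots hpoly
    have hr : ∀ z : Fin N → ℝ, (∏ i, (Polynomial.X - Polynomial.C (z i))).roots =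
        Multiset.map z Finset.univ.val := by
      intro z
      have := Polynomial.roots_multiset_prod_X_sub_C (Multiset.map z Finset.univ.val)
      rwa [Multiset.map_map] at this
    rwa [hr, hr] at h
  have hlist : List.Perm (List.ofFn x) (List.ofFn y) := by
    rw [← Multiset.coe_eq_coe, List.ofFn_eq_map, List.ofFn_eq_map, ← Multiset.map_coe,
      ← Multiset.map_coe]
    exact hroots
  have := hlist.eq_of_sortedGE (Antitone.sortedGE_ofFn hx) (Antitone.sortedGE_ofFn hy)
  exact List.ofFn_injective this

lemma isClosed_weylChamber (N : ℕ) : IsClosed (weylChamber N) := by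
  have : weylChamber N = ⋂ i : Fin N, ⋂ j : Fin N, ⋂ _ : i ≤ j, {x | x j ≤ x i} := by
    ext x; simp [weylChamber, Antitone]
  rw [this]
  exact isClosed_iInter fun i => isClosed_iInter fun j => isClosed_iInter fun _ =>
    isClosed_le (continuous_apply _) (continuous_apply _)

lemma measurable_val_entry (i j : Fin N) :
    Measurable fun H : HermitianMatrix (Fin N) => H.1 i j :=
  (measurable_pi_apply j).comp ((measurable_pi_apply i).comp measurable_subtype_coe)

/-- Measurability of the ordered eigenvalues follows from that of the characteristic polynomial:
on the Weyl chamber, the map from roots to polynomials is continuous and injective, hence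
a measurable embedding by the Lusin-Souslin theorem. -/
lemma measurable_orderedEigenvalues :
    Measurable (orderedEigenvalues : HermitianMatrix (Fin N) → Fin N → ℝ) := by
  have hemb := ContinuousOn.measurableEmbedding (isClosed_weylChamber N).measurableSet
    (continuous_rootProducts (N := N)).continuousOn injOn_rootProducts
  let f : HermitianMatrix (Fin N) → weylChamber N :=
    fun H => ⟨orderedEigenvalues H, antitone_orderedEigenvalues H⟩
  suffices hf : Measurable f from measurable_subtype_coe.comp hf
  rw [← hemb.measurable_comp_iff]
  refine measurable_pi_iff.2 fun q => ?_
  have h : (fun H : HermitianMatrix (Fin N) =>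
      ((weylChamber N).domRestrict rootProducts ∘ f) H q) =
      fun H => (Matrix.scalar (Fin N) (q : ℂ) - H.1).det.re := by
    funext H
    rw [det_sub_eq_prod]
    change ∏ i, ((q : ℝ) - orderedEigenvalues H i) = _
    have : (∏ i, ((q : ℂ) - (orderedEigenvalues H i : ℂ))) =
      ((∏ i, ((q : ℝ) - orderedEigenvalues H i) : ℝ) : ℂ) := by push_cast; rfl
    rw [this, Complex.ofReal_re]
  rw [h]
  refine Complex.measurable_re.comp ?_
  simp only [Matrix.det_apply]
  refine Finset.measurable_sum _ fun σ _ => ?_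
  refine Measurable.const_smul (Finset.measurable_prod _ fun i _ => ?_) _
  simp only [Matrix.sub_apply]
  exact (measurable_const).sub (measurable_val_entry _ _)

end Eigenvalues

end MomentsAndEigenvalues

/-! ### Symmetrised Gaussian weights -/

section Symmetrization

open MvPolynomial

/-- The sum over all permutations of the coordinates of the image of `γ` under `y`. -/
noncomputable def symmetrize {α : Type*} [MeasurableSpace α] {N : ℕ} (γ : Measure α)
    (y : α → Fin N → ℝ) : Measure (Fin N → ℝ) :=
  ∑ σ : Equiv.Perm (Fin N), γ.map fun x => y x ∘ σ

lemma measurable_comp_perm {α : Type*} [MeasurableSpace α] {N : ℕ} {y : α → Fin N → ℝ}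
    (hy : Measurable y) (σ : Equiv.Perm (Fin N)) : Measurable fun x => y x ∘ σ :=
  measurable_pi_iff.2 fun i => (measurable_pi_apply (σ i)).comp hy

lemma norm_comp_perm_le {N : ℕ} (x : Fin N → ℝ) (σ : Equiv.Perm (Fin N)) : ‖x ∘ σ‖ ≤ ‖x‖ :=
  (pi_norm_le_iff_of_nonneg (norm_nonneg _)).2 fun i => norm_le_pi_norm x (σ i)

lemma abs_dual_comp_le {V : Type*} [NormedAddCommGroup V] {N : ℕ} {y : V → Fin N → ℝ} {K : ℝ}
    (hyK : ∀ x, ‖y x‖ ≤ K * ‖x‖) (L : StrongDual ℝ (Fin N → ℝ)) (σ : Equiv.Perm (Fin N)) (x : V) :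
    |L (y x ∘ σ)| ≤ (‖L‖ * K) * ‖x‖ := by
  calc |L (y x ∘ σ)| ≤ ‖L‖ * ‖y x ∘ σ‖ := L.le_opNorm _
    _ ≤ ‖L‖ * (K * ‖x‖) := by
        gcongr
        exact (norm_comp_perm_le _ _).trans (hyK x)
    _ = _ := by ring

lemma lintegral_symmetrize {α : Type*} [MeasurableSpace α] {N : ℕ} (γ : Measure α)
    {y : α → Fin N → ℝ} (hy : Measurable y) {F : (Fin N → ℝ) → ENNReal} (hF : Measurable F)
    (hsym : ∀ (σ : Equiv.Perm (Fin N)) x, F (x ∘ σ) = F x) :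
    ∫⁻ x, F x ∂(symmetrize γ y) = N.factorial * ∫⁻ x, F (y x) ∂γ := by
  rw [symmetrize, lintegral_finsetSum_measure]
  simp [lintegral_map hF (measurable_comp_perm hy _), hsym, Fintype.card_perm]

section Gaussian

variable {V : Type*} [NormedAddCommGroup V] [NormedSpace ℝ V]
  [MeasurableSpace V] [BorelSpace V] {ι : Type*} [Fintype ι] (ℓ : ι → V →L[ℝ] ℂ)
  (μ : Measure V)

/-- The measure with density `w(x) exp(-½ ∑ᵢ |ℓᵢ(x)|²)`. -/
noncomputable def gaussianWeight (w : V → ℝ) : Measure V :=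
  μ.withDensity fun x => ENNReal.ofReal (w x * Real.exp (-quadForm ℓ x))

variable {w : V → ℝ} (hw : ∀ x, 0 ≤ w x) (hwm : Measurable w)

include hw hwm in
lemma integral_gaussianWeight (f : V → ℂ) :
    ∫ x, f x ∂(gaussianWeight ℓ μ w) =
      ∫ x, w x * f x * (Real.exp (-quadForm ℓ x) : ℂ) ∂μ := by
  have hm : Measurable fun x => w x * Real.exp (-quadForm ℓ x) :=
    hwm.mul (Real.measurable_exp.comp (continuous_quadForm ℓ).measurable.neg)
  rw [gaussianWeight, integral_withDensity_eq_integral_toReal_smul hm.ennreal_ofReal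
    (Filter.Eventually.of_forall fun x => ENNReal.ofReal_lt_top)]
  refine integral_congr_ae (Filter.Eventually.of_forall fun x => ?_)
  have h0 : 0 ≤ w x * Real.exp (-quadForm ℓ x) := mul_nonneg (hw x) (Real.exp_pos _).le
  simp only [ENNReal.toReal_ofReal h0, Complex.real_smul]
  push_cast
  ring

variable [FiniteDimensional ℝ V] [μ.IsAddHaarMeasure] {b : ℝ} (hb : 0 < b)
  (hQ : ∀ x, b * ‖x‖ ^ 2 ≤ quadForm ℓ x) {p : MvPolynomial ι ℂ}
  (hp : ∀ x, evalCoords ℓ p x = w x)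

include hb hQ hw hwm hp in
lemma integrable_gaussianWeight {f : V → ℂ} (hf : Measurable f) {C a : ℝ}
    (hfb : ∀ x, ‖f x‖ ≤ C * Real.exp (a * ‖x‖)) : Integrable f (gaussianWeight ℓ μ w) := by
  have hm : Measurable fun x => w x * Real.exp (-quadForm ℓ x) :=
    hwm.mul (Real.measurable_exp.comp (continuous_quadForm ℓ).measurable.neg)
  rw [gaussianWeight, integrable_withDensity_iff_integrable_smul' hm.ennreal_ofReal
    (Filter.Eventually.of_forall fun x => ENNReal.ofReal_lt_top)]
  obtain ⟨C', a', -, hC', h'⟩ := exists_evalCoords_bound ℓ p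
  have := integrable_mul_exp_neg (μ := μ) (f := fun x => f x * w x) (C := C * C') (a := a + a')
    hb hQ (continuous_quadForm ℓ)
    (hf.mul (Complex.measurable_ofReal.comp hwm)).aestronglyMeasurable (fun x => by
      rw [norm_mul, ← hp, add_mul, Real.exp_add]
      calc _ ≤ (C * Real.exp (a * ‖x‖)) * (C' * Real.exp (a' * ‖x‖)) :=
            mul_le_mul (hfb x) (h' x) (norm_nonneg _) ((norm_nonneg _).trans (hfb x))
        _ = _ := by ring)
  refine this.congr (Filter.Eventually.of_forall fun x => ?_)
  have h0 : 0 ≤ w x * Real.exp (-quadForm ℓ x) := mul_nonneg (hw x) (Real.exp_pos _).le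
  simp only [ENNReal.toReal_ofReal h0, Complex.real_smul]
  push_cast
  ring

include hb hQ hw hwm hp in
lemma isFiniteMeasure_gaussianWeight : IsFiniteMeasure (gaussianWeight ℓ μ w) := by
  have := integrable_gaussianWeight ℓ μ hw hwm hb hQ hp (f := fun _ => 1) measurable_const
    (C := 1) (a := 0) (by simp)
  rw [integrable_const_iff] at this
  simpa using this

variable {N : ℕ} {y : V → Fin N → ℝ} (hy : Measurable y) {K : ℝ} (hyK : ∀ x, ‖y x‖ ≤ K * ‖x‖)

include hb hQ hw hwm hp hy hyK in
lemma integrable_exp_symmetrize (L : StrongDual ℝ (Fin N → ℝ)) :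
    Integrable (fun v => Real.exp |L v|) (symmetrize (gaussianWeight ℓ μ w) y) := by
  rw [symmetrize, integrable_finsetSum_measure]
  intro σ _
  rw [integrable_map_measure (Continuous.aestronglyMeasurable (by fun_prop))
    (measurable_comp_perm hy σ).aemeasurable]
  have := integrable_gaussianWeight ℓ μ hw hwm hb hQ hp
    (f := fun x => ((Real.exp |L (y x ∘ σ)| : ℝ) : ℂ)) (C := 1) (a := ‖L‖ * K)
    (Complex.measurable_ofReal.comp (((by fun_prop : Continuous fun v => Real.exp |L v|)
      ).measurable.comp (measurable_comp_perm hy σ)))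
    (fun x => by
      rw [Complex.norm_real, Real.norm_eq_abs, Real.abs_exp, one_mul]
      exact Real.exp_le_exp.2 (abs_dual_comp_le hyK L σ x))
  exact this.re

include hb hQ hw hwm hp hy hyK in
lemma integral_pow_symmetrize (L : StrongDual ℝ (Fin N → ℝ)) (n : ℕ) :
    ∫ v, (L v : ℂ) ^ n ∂(symmetrize (gaussianWeight ℓ μ w) y) =
      ∫ x, (∑ σ : Equiv.Perm (Fin N), (L (y x ∘ σ) : ℂ) ^ n) ∂(gaussianWeight ℓ μ w) := by
  have hint : ∀ σ : Equiv.Perm (Fin N),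
      Integrable (fun x => (L (y x ∘ σ) : ℂ) ^ n) (gaussianWeight ℓ μ w) := by
    intro σ
    refine integrable_gaussianWeight ℓ μ hw hwm hb hQ hp
      (((by fun_prop : Continuous fun v => (L v : ℂ) ^ n)).measurable.comp
        (measurable_comp_perm hy σ)) (C := n.factorial) (a := ‖L‖ * K) fun x => ?_
    rw [norm_pow, Complex.norm_real, Real.norm_eq_abs]
    have h1 := Real.pow_div_factorial_le_exp _ (abs_nonneg (L (y x ∘ σ))) n
    rw [div_le_iff₀ (by positivity), mul_comm] at h1
    refine h1.trans ?_
    gcongr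
    exact abs_dual_comp_le hyK L σ x
  rw [integral_finsetSum _ fun σ _ => hint σ, symmetrize, integral_finsetSum_measure]
  · refine Finset.sum_congr rfl fun σ _ => ?_
    rw [integral_map (measurable_comp_perm hy σ).aemeasurable
      (Continuous.aestronglyMeasurable (by fun_prop))]
  · intro σ _
    rw [integrable_map_measure (Continuous.aestronglyMeasurable (by fun_prop))
      (measurable_comp_perm hy σ).aemeasurable]
    exact hint σ

include hb hQ hw hwm hp in
/-- Integrating the polynomial `q` against the Gaussian weighted by the polynomial `p` gives the
Gaussian functional at `p * q`. -/
lemma integral_eval_gaussianWeight {q : MvPolynomial ι ℂ} {f : V → ℂ}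
    (hq : ∀ x, evalCoords ℓ q x = f x) :
    ∫ x, f x ∂(gaussianWeight ℓ μ w) = gaussianFunctional ℓ μ hb hQ (p * q) := by
  rw [integral_gaussianWeight ℓ μ hw hwm]
  refine integral_congr_ae (Filter.Eventually.of_forall fun x => ?_)
  have h : evalCoords ℓ (p * q) x = w x * f x := by
    rw [← hp, ← hq]; simp [evalCoords]
  simp only [h]

end Gaussian

/-- The symmetric polynomial `∑_σ (∑ᵢ L(eᵢ) x_{σ(i)}) ^ n`. -/
noncomputable def momentPoly {N : ℕ} (L : StrongDual ℝ (Fin N → ℝ)) (n : ℕ) :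
    MvPolynomial (Fin N) ℂ :=
  ∑ σ : Equiv.Perm (Fin N), rename σ ((∑ i, C (L (Pi.single i 1) : ℂ) * X i) ^ n)

lemma isSymmetric_momentPoly {N : ℕ} (L : StrongDual ℝ (Fin N → ℝ)) (n : ℕ) :
    (momentPoly L n).IsSymmetric := by
  intro τ
  simp only [momentPoly, map_sum, rename_rename]
  exact Equiv.sum_comp (Equiv.mulLeft τ) fun σ : Equiv.Perm (Fin N) =>
    rename σ ((∑ i, C (L (Pi.single i 1) : ℂ) * X i) ^ n)

lemma eval_momentPoly {N : ℕ} (L : StrongDual ℝ (Fin N → ℝ)) (n : ℕ) (x : Fin N → ℝ) :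
    eval (fun i => (x i : ℂ)) (momentPoly L n) =
      ∑ σ : Equiv.Perm (Fin N), (L (x ∘ σ) : ℂ) ^ n := by
  simp only [momentPoly, map_sum, eval_rename]
  refine Finset.sum_congr rfl fun σ _ => ?_
  have hL : L (x ∘ σ) = ∑ i, L (Pi.single i 1) * x (σ i) := by
    conv_lhs => rw [pi_eq_sum_univ' (x ∘ σ), map_sum]
    refine Finset.sum_congr rfl fun i _ => ?_
    rw [map_smul, smul_eq_mul, mul_comm]
    congr 2
  rw [hL]
  simp

end Symmetrization

/-! ### Gaussian eigenvalues in matrix coordinates -/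

section GaussianComparison

open MvPolynomial

instance instIsAddHaarMeasureHermitianCoords (N : ℕ) :
    (volume : Measure (HermitianCoords N)).IsAddHaarMeasure := by
  exact Measure.prod.instIsAddHaarMeasure _ _

section Coordinates

variable {N : ℕ}

/-- The `(i, j)` entry as a real-linear function of the coordinates. -/
noncomputable def entryCLM (i j : Fin N) : HermitianCoords N →L[ℝ] ℂ :=
  LinearMap.toContinuousLinearMap
    { toFun := fun c => entryOfCoords c i j
      map_add' := fun c d => by
        unfold entryOfCoords
        split_ifs <;> simp
      map_smul' := fun r c => by
        unfold entryOfCoords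
        split_ifs <;> simp }

@[simp] lemma entryCLM_apply (i j : Fin N) (c : HermitianCoords N) :
    entryCLM i j c = entryOfCoords c i j := rfl

lemma hermitianOfCoords_apply (c : HermitianCoords N) (i j : Fin N) :
    (hermitianOfCoords c).1 i j = entryOfCoords c i j := rfl

lemma entryOfCoords_diag (c : HermitianCoords N) (i : Fin N) :
    entryOfCoords c i i = c.1 i := by
  simp [entryOfCoords]

lemma entryOfCoords_upper (c : HermitianCoords N) (p : {p : Fin N × Fin N // p.1 < p.2}) :
    entryOfCoords c p.1.1 p.1.2 = c.2 p := by
  simp [entryOfCoords, p.2]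

lemma entryOfCoords_star (c : HermitianCoords N) (i j : Fin N) :
    entryOfCoords c j i = star (entryOfCoords c i j) := by
  have := (hermitianOfCoords c).2.apply j i
  simpa [hermitianOfCoords_apply] using this.symm

lemma coords_ext {c d : HermitianCoords N} (h : ∀ i j, entryOfCoords c i j = entryOfCoords d i j) :
    c = d := by
  refine Prod.ext (funext fun i => ?_) (funext fun p => ?_)
  · have := h i i
    rwa [entryOfCoords_diag, entryOfCoords_diag, Complex.ofReal_inj] at this
  · rw [← entryOfCoords_upper, ← entryOfCoords_upper, h]

/-- The coordinates of a matrix, read off its diagonal and its upper triangle. -/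
noncomputable def coordsOfMatrix (M : Matrix (Fin N) (Fin N) ℂ) : HermitianCoords N :=
  (fun i => (M i i).re, fun p => M p.1.1 p.1.2)

lemma entryOfCoords_coordsOfMatrix {M : Matrix (Fin N) (Fin N) ℂ} (hM : M.IsHermitian)
    (i j : Fin N) : entryOfCoords (coordsOfMatrix M) i j = M i j := by
  unfold entryOfCoords coordsOfMatrix
  split_ifs with h h'
  · rfl
  · exact hM.apply i j
  · have : i = j := le_antisymm (not_lt.1 h') (not_lt.1 h)
    subst this
    exact hM.coe_re_apply_self i

lemma norm_entryOfCoords_le (c : HermitianCoords N) (i j : Fin N) :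
    ‖entryOfCoords c i j‖ ≤ ‖c‖ := by
  unfold entryOfCoords
  split_ifs with h h'
  · exact (norm_le_pi_norm c.2 _).trans (norm_snd_le c)
  · rw [norm_star]
    exact (norm_le_pi_norm c.2 _).trans (norm_snd_le c)
  · rw [Complex.norm_real]
    exact (norm_le_pi_norm c.1 _).trans (norm_fst_le c)

lemma norm_sq_le_sum_entry (c : HermitianCoords N) :
    ‖c‖ ^ 2 ≤ ∑ q : Fin N × Fin N, ‖entryOfCoords c q.1 q.2‖ ^ 2 := by
  set S := ∑ q : Fin N × Fin N, ‖entryOfCoords c q.1 q.2‖ ^ 2 with hS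
  have hle : ∀ i j, ‖entryOfCoords c i j‖ ≤ √S := fun i j =>
    Real.le_sqrt_of_sq_le (Finset.single_le_sum
      (f := fun q : Fin N × Fin N => ‖entryOfCoords c q.1 q.2‖ ^ 2)
      (fun _ _ => by positivity) (Finset.mem_univ (i, j)))
  have h : ‖c‖ ≤ √S := by
    rw [norm_prod_le_iff]
    refine ⟨(pi_norm_le_iff_of_nonneg (Real.sqrt_nonneg _)).2 fun i => ?_,
      (pi_norm_le_iff_of_nonneg (Real.sqrt_nonneg _)).2 fun p => ?_⟩
    · have := hle i i
      rwa [entryOfCoords_diag, Complex.norm_real] at this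
    · rw [← entryOfCoords_upper]
      exact hle _ _
  calc ‖c‖ ^ 2 ≤ √S ^ 2 := by gcongr
    _ = S := Real.sq_sqrt (by positivity)

end Coordinates

/-- The family of all entries, as linear coordinates for the Gaussian weight `exp(-½ tr H²)`. -/
noncomputable abbrev entryFamily (N : ℕ) : Fin N × Fin N → HermitianCoords N →L[ℝ] ℂ :=
  fun q => entryCLM q.1 q.2

/-- The coordinate functions on `ℝᴺ`, with complex values. -/
noncomputable abbrev realFamily (N : ℕ) : Fin N → (Fin N → ℝ) →L[ℝ] ℂ :=
  fun i => Complex.ofRealCLM ∘L ContinuousLinearMap.proj i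

lemma le_quadForm_entryFamily {N : ℕ} (c : HermitianCoords N) :
    (1 / 2 : ℝ) * ‖c‖ ^ 2 ≤ quadForm (entryFamily N) c := by
  unfold quadForm
  have := norm_sq_le_sum_entry c
  simp only [entryCLM_apply]
  linarith

lemma quadForm_realFamily {N : ℕ} (x : Fin N → ℝ) :
    quadForm (realFamily N) x = (1 / 2) * ∑ i, x i ^ 2 := by
  simp [quadForm]

lemma le_quadForm_realFamily {N : ℕ} (x : Fin N → ℝ) :
    (1 / 2 : ℝ) * ‖x‖ ^ 2 ≤ quadForm (realFamily N) x := by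
  rw [quadForm_realFamily]
  have h : ‖x‖ ≤ √(∑ i, x i ^ 2) :=
    (pi_norm_le_iff_of_nonneg (Real.sqrt_nonneg _)).2 fun i => by
      refine Real.le_sqrt_of_sq_le ?_
      rw [Real.norm_eq_abs, sq_abs]
      exact Finset.single_le_sum (f := fun i => x i ^ 2) (fun _ _ => by positivity)
        (Finset.mem_univ i)
  have h2 : ‖x‖ ^ 2 ≤ ∑ i, x i ^ 2 := by
    calc ‖x‖ ^ 2 ≤ √(∑ i, x i ^ 2) ^ 2 := by gcongr
      _ = _ := Real.sq_sqrt (by positivity)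
  linarith

/-- The Gaussian functional on polynomials in the entries of a Hermitian matrix. -/
noncomputable def matrixGaussian (N : ℕ) : MvPolynomial (Fin N × Fin N) ℂ →ₗ[ℂ] ℂ :=
  gaussianFunctional (entryFamily N) volume (b := 1 / 2) (by norm_num) le_quadForm_entryFamily

/-- The Gaussian functional on polynomials in `N` real variables. -/
noncomputable def vectorGaussian (N : ℕ) : MvPolynomial (Fin N) ℂ →ₗ[ℂ] ℂ :=
  gaussianFunctional (realFamily N) volume (b := 1 / 2) (by norm_num) le_quadForm_realFamily

lemma matrixGaussian_X_mul (N : ℕ) (i j : Fin N) (p : MvPolynomial (Fin N × Fin N) ℂ) :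
    matrixGaussian N (X (i, j) * p) = matrixGaussian N (pderiv (j, i) p) := by
  refine gaussianFunctional_X_mul (entryFamily N) volume (b := 1 / 2) (by norm_num)
    le_quadForm_entryFamily Prod.swap Prod.swap_swap (fun q c => ?_) (fun q => ?_) (j, i) p
  · exact entryOfCoords_star c q.1 q.2
  · -- A matrix unit `E` is `A + i B` with `A = (E + E*) / 2` and `B = (E - E*) / (2i)` Hermitian.
    set E : Matrix (Fin N) (Fin N) ℂ := Matrix.single q.1 q.2 1 with hE
    have hA : ((1 / 2 : ℂ) • (E + E.conjTranspose)).IsHermitian := by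
      rw [Matrix.IsHermitian, Matrix.conjTranspose_smul, Matrix.conjTranspose_add,
        Matrix.conjTranspose_conjTranspose, add_comm]
      simp
    have hB : ((-Complex.I / 2 : ℂ) • (E - E.conjTranspose)).IsHermitian := by
      rw [Matrix.IsHermitian, Matrix.conjTranspose_smul, Matrix.conjTranspose_sub,
        Matrix.conjTranspose_conjTranspose, ← neg_sub, smul_neg, ← neg_smul]
      congr 1
      simp [neg_div]
    refine ⟨coordsOfMatrix ((1 / 2 : ℂ) • (E + E.conjTranspose)),
      coordsOfMatrix ((-Complex.I / 2 : ℂ) • (E - E.conjTranspose)), fun r => ?_⟩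
    rw [entryCLM_apply, entryCLM_apply, entryOfCoords_coordsOfMatrix hA,
      entryOfCoords_coordsOfMatrix hB]
    have : E r.1 r.2 = if q = r then 1 else 0 := by
      simp [hE, Matrix.single_apply, Prod.ext_iff]
    rw [← this]
    simp only [Matrix.smul_apply, Matrix.add_apply, Matrix.sub_apply, smul_eq_mul]
    linear_combination (-(1 : ℂ) / 2 * (E r.1 r.2 - E.conjTranspose r.1 r.2)) * Complex.I_sq

lemma vectorGaussian_X_mul (N : ℕ) (i : Fin N) (p : MvPolynomial (Fin N) ℂ) :
    vectorGaussian N (X i * p) = vectorGaussian N (pderiv i p) := by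
  refine gaussianFunctional_X_mul (realFamily N) volume (b := 1 / 2) (by norm_num)
    le_quadForm_realFamily id (fun _ => rfl) (fun q c => by simp) (fun q => ?_) i p
  refine ⟨Pi.single q 1, 0, fun j => ?_⟩
  rcases eq_or_ne q j with rfl | h
  · simp
  · simp [h, h.symm]

section Weyl

variable {N : ℕ}

/-- The ordered eigenvalues of the Hermitian matrix with the given coordinates. -/
noncomputable def eigenvaluesOfCoords (c : HermitianCoords N) : Fin N → ℝ :=
  orderedEigenvalues (hermitianOfCoords c)

lemma measurable_eigenvaluesOfCoords :
    Measurable (eigenvaluesOfCoords : HermitianCoords N → Fin N → ℝ) :=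
  measurable_orderedEigenvalues.comp (measurable_hermitianOfCoords N)

lemma quadForm_entryFamily (c : HermitianCoords N) :
    quadForm (entryFamily N) c = (1 / 2) * ∑ i, eigenvaluesOfCoords c i ^ 2 := by
  have h1 := trace_pow_eq_sum (hermitianOfCoords c) 2
  have h2 : ((hermitianOfCoords c).1 ^ 2).trace =
      ((∑ q : Fin N × Fin N, ‖entryOfCoords c q.1 q.2‖ ^ 2 : ℝ) : ℂ) := by
    rw [pow_two, Matrix.trace, Fintype.sum_prod_type]
    push_cast
    refine Finset.sum_congr rfl fun i _ => ?_
    rw [Matrix.diag_apply, Matrix.mul_apply]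
    refine Finset.sum_congr rfl fun j _ => ?_
    rw [hermitianOfCoords_apply, hermitianOfCoords_apply, entryOfCoords_star c i j]
    exact Complex.mul_conj' _
  rw [h2] at h1
  unfold quadForm eigenvaluesOfCoords
  congr 1
  exact_mod_cast h1

lemma norm_eigenvaluesOfCoords_le (c : HermitianCoords N) :
    ‖eigenvaluesOfCoords c‖ ≤ N * ‖c‖ := by
  refine (pi_norm_le_iff_of_nonneg (by positivity)).2 fun i => ?_
  refine abs_le_of_sq_le_sq ?_ (by positivity)
  have h1 : eigenvaluesOfCoords c i ^ 2 ≤ ∑ i, eigenvaluesOfCoords c i ^ 2 :=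
    Finset.single_le_sum (f := fun i => eigenvaluesOfCoords c i ^ 2) (fun _ _ => by positivity)
        (Finset.mem_univ i)
  have h2 : ∑ q : Fin N × Fin N, ‖entryOfCoords c q.1 q.2‖ ^ 2 ≤ (N * ‖c‖) ^ 2 := by
    calc _ ≤ ∑ q : Fin N × Fin N, ‖c‖ ^ 2 := by
          gcongr with q
          exact norm_entryOfCoords_le c _ _
      _ = _ := by simp; ring
  have h3 := quadForm_entryFamily c
  unfold quadForm at h3
  simp only [entryCLM_apply] at h3
  linarith

lemma evalCoords_traceHom (P : MvPolynomial ℕ ℂ) (c : HermitianCoords N) :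
    evalCoords (entryFamily N) (traceHom N P) c =
      eval (fun i => (eigenvaluesOfCoords c i : ℂ)) (psumHom N P) := by
  have h1 : ∀ l, eval (fun q => entryFamily N q c) (genericMatrix N ^ l).trace =
      ∑ i, (eigenvaluesOfCoords c i : ℂ) ^ l := by
    intro l
    have h : ((genericMatrix N).map (eval fun q => entryFamily N q c)) =
        (hermitianOfCoords c).1 := by
      ext i j : 2
      simp [hermitianOfCoords_apply]
    rw [eigenvaluesOfCoords, ← trace_pow_eq_sum, ← h]
    rw [← RingHom.mapMatrix_apply, ← map_pow, RingHom.mapMatrix_apply, Matrix.trace,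
      Matrix.trace, map_sum]
    rfl
  unfold evalCoords traceHom psumHom
  induction P using MvPolynomial.induction_on with
  | C a => simp
  | add P Q hP hQ => simp only [map_add, hP, hQ]
  | mul_X P l hP =>
    rw [map_mul, map_mul, map_mul, map_mul, hP, aeval_X, aeval_X, h1]
    simp [psum]

lemma eval_vandermondePoly (x : Fin N → ℝ) :
    evalCoords (realFamily N) (vandermondePoly N ^ 2) x = ((vandermondeProd x ^ 2 : ℝ) : ℂ) := by
  simp [evalCoords, vandermondePoly, vandermondeProd]

lemma continuous_vandermondeProd : Continuous (vandermondeProd : (Fin N → ℝ) → ℝ) := by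
  unfold vandermondeProd
  fun_prop

/-- The symmetrised law of Gaussian eigenvalues agrees with the symmetrisation of
`Δ(x)² exp(-½ ∑ xᵢ²) dx`, up to normalisation. -/
lemma symmetrize_matrix_eq (A B : NNReal) (hA : ((A : ℝ) : ℂ) = matrixGaussian N 1)
    (hB : ((B : ℝ) : ℂ) = vectorGaussian N (vandermondePoly N ^ 2)) :
    B • symmetrize (gaussianWeight (entryFamily N) volume fun _ => 1) eigenvaluesOfCoords =
      A • symmetrize (gaussianWeight (realFamily N) volume fun x => vandermondeProd x ^ 2)
        id := by
  have hb : (0 : ℝ) < 1 / 2 := by norm_num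
  have hwm := (continuous_vandermondeProd (N := N)).measurable.pow_const 2
  have hw : ∀ x : Fin N → ℝ, 0 ≤ vandermondeProd x ^ 2 := fun x => sq_nonneg _
  have hp1 : ∀ c : HermitianCoords N, evalCoords (entryFamily N) 1 c = ((1 : ℝ) : ℂ) :=
    fun c => by simp [evalCoords]
  have hw1 : ∀ c : HermitianCoords N, (0 : ℝ) ≤ 1 := fun _ => zero_le_one
  have := isFiniteMeasure_gaussianWeight (entryFamily N) volume (w := fun _ => 1) hw1
    measurable_const hb le_quadForm_entryFamily hp1
  have := isFiniteMeasure_gaussianWeight (realFamily N) volume hw hwm hb le_quadForm_realFamily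
    eval_vandermondePoly
  have hfin : ∀ {α : Type} [MeasurableSpace α] (γ : Measure α) [IsFiniteMeasure γ]
      (y : α → Fin N → ℝ), IsFiniteMeasure (symmetrize γ y) := by
    intro α _ γ _ y
    unfold symmetrize
    infer_instance
  have := hfin (gaussianWeight (entryFamily N) volume fun _ => 1) eigenvaluesOfCoords
  have := hfin (gaussianWeight (realFamily N) volume fun x => vandermondeProd x ^ 2) id
  refine measure_ext_of_moments (fun L => ?_) (fun L => ?_) fun L n => ?_
  · exact (integrable_exp_symmetrize _ _ hw1 measurable_const hb le_quadForm_entryFamily hp1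
      measurable_eigenvaluesOfCoords norm_eigenvaluesOfCoords_le L).smul_measure_nnreal
  · exact (integrable_exp_symmetrize _ _ hw hwm hb le_quadForm_realFamily eval_vandermondePoly
      measurable_id (K := 1) (fun x => by simp) L).smul_measure_nnreal
  · obtain ⟨P, hP⟩ := exists_psumHom_eq (isSymmetric_momentPoly L n)
    rw [integral_smul_nnreal_measure, integral_smul_nnreal_measure,
      integral_pow_symmetrize _ _ hw1 measurable_const hb le_quadForm_entryFamily hp1
        measurable_eigenvaluesOfCoords norm_eigenvaluesOfCoords_le,
      integral_pow_symmetrize _ _ hw hwm hb le_quadForm_realFamily eval_vandermondePoly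
        measurable_id (K := 1) (fun x => by simp)]
    rw [integral_eval_gaussianWeight _ _ hw1 measurable_const hb le_quadForm_entryFamily hp1
      (q := traceHom N P) (fun c => by rw [evalCoords_traceHom, hP, eval_momentPoly]),
      integral_eval_gaussianWeight _ _ hw hwm hb le_quadForm_realFamily eval_vandermondePoly
      (q := psumHom N P) (fun x => by rw [hP]; exact eval_momentPoly L n x)]
    have key := trace_functional_eq N (matrixGaussian N) (matrixGaussian_X_mul N)
      (vectorGaussian N) (vectorGaussian_X_mul N) P
    rw [← hA, ← hB] at key
    rw [one_mul, NNReal.smul_def, NNReal.smul_def, Complex.real_smul, Complex.real_smul]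
    exact key

end Weyl

end GaussianComparison

/-! ### The Weyl integration formula -/

section WeylIntegration

open MvPolynomial

variable {N : ℕ}

lemma vandermondeProd_sq_comp_perm (σ : Equiv.Perm (Fin N)) (x : Fin N → ℝ) :
    vandermondeProd (x ∘ σ) ^ 2 = vandermondeProd x ^ 2 := by
  have h : ∀ y : Fin N → ℝ, vandermondeProd y = (Matrix.vandermonde y).det := fun y =>
    (Matrix.det_vandermonde y).symm
  have h2 : Matrix.vandermonde (x ∘ σ) = (Matrix.vandermonde x).submatrix σ id := rfl
  rw [h, h, h2, Matrix.det_permute, mul_pow]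
  have : ((Equiv.Perm.sign σ : ℤ) : ℝ) ^ 2 = 1 := by
    rcases Int.units_eq_one_or (Equiv.Perm.sign σ) with h | h <;> simp [h]
  rw [this, one_mul]

lemma vandermondeProd_eq_zero_of_not_injective {x : Fin N → ℝ} (hx : ¬ Function.Injective x) :
    vandermondeProd x = 0 := by
  have h : vandermondeProd x = (Matrix.vandermonde x).det := (Matrix.det_vandermonde x).symm
  rw [h]
  by_contra hne
  exact hx (Matrix.det_vandermonde_ne_zero_iff.1 hne)

lemma exists_vandermondeProd_ne_zero : ∃ x : Fin N → ℝ, vandermondeProd x ≠ 0 := by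
  refine ⟨fun i => (i : ℕ), ?_⟩
  have h : ∀ x : Fin N → ℝ, vandermondeProd x = (Matrix.vandermonde x).det := fun x =>
    (Matrix.det_vandermonde x).symm
  rw [h, Matrix.det_vandermonde_ne_zero_iff]
  intro i j hij
  have h' : ((i : ℕ) : ℝ) = (j : ℕ) := hij
  exact Fin.ext (by exact_mod_cast h')

lemma measurePreserving_comp_perm (σ : Equiv.Perm (Fin N)) :
    MeasurePreserving (fun x : Fin N → ℝ => x ∘ σ) volume volume := by
  have := volume_measurePreserving_piCongrLeft (fun _ : Fin N => ℝ) σ.symm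
  convert this using 1
  ext x i
  obtain ⟨j, rfl⟩ := σ.symm.surjective i
  rw [MeasurableEquiv.piCongrLeft_apply_apply]
  simp

lemma sum_indicator_weylChamber {x : Fin N → ℝ} (hx : Function.Injective x) :
    ∑ σ : Equiv.Perm (Fin N),
      (weylChamber N).indicator (1 : (Fin N → ℝ) → ENNReal) (x ∘ σ) = 1 := by
  classical
  have hanti : ∃ σ : Equiv.Perm (Fin N), Antitone (x ∘ σ) := by
    refine ⟨Tuple.sort fun i => -x i, fun i j hij => ?_⟩
    have := Tuple.monotone_sort (fun i => -x i) hij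
    simpa using this
  obtain ⟨σ, hσ⟩ := hanti
  rw [Finset.sum_eq_single σ]
  · exact Set.indicator_of_mem hσ _
  · intro τ _ hτ
    refine Set.indicator_of_notMem (fun hmem => hτ ?_) _
    have := Tuple.unique_antitone hmem hσ
    exact Equiv.ext fun i => hx (congrFun this i)
  · simp

/-- The integral of a symmetric function vanishing on ties is `N!` times its integral over the Weyl
chamber, as exactly one permutation sorts a vector with distinct coordinates. -/
lemma lintegral_eq_factorial_mul_weylChamber {G : (Fin N → ℝ) → ENNReal} (hG : Measurable G)
    (hsym : ∀ (σ : Equiv.Perm (Fin N)) x, G (x ∘ σ) = G x)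
    (hzero : ∀ x, ¬ Function.Injective x → G x = 0) :
    ∫⁻ x, G x = N.factorial * ∫⁻ x in weylChamber N, G x := by
  have hW := (isClosed_weylChamber N).measurableSet
  have h1 : ∀ x, G x = ∑ σ : Equiv.Perm (Fin N), (weylChamber N).indicator G (x ∘ σ) := by
    intro x
    by_cases hx : Function.Injective x
    · have : ∀ σ : Equiv.Perm (Fin N), (weylChamber N).indicator G (x ∘ σ) =
          G x * (weylChamber N).indicator (1 : (Fin N → ℝ) → ENNReal) (x ∘ σ) := by
        intro σ
        by_cases h : x ∘ σ ∈ weylChamber N <;> simp [h, hsym]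
      simp only [this]
      rw [← Finset.mul_sum, sum_indicator_weylChamber hx, mul_one]
    · rw [hzero x hx]
      refine (Finset.sum_eq_zero fun σ _ => ?_).symm
      by_cases h : x ∘ σ ∈ weylChamber N <;> simp [h, hsym, hzero x hx]
  calc ∫⁻ x, G x = ∫⁻ x, ∑ σ : Equiv.Perm (Fin N), (weylChamber N).indicator G (x ∘ σ) :=
        lintegral_congr h1
    _ = ∑ σ : Equiv.Perm (Fin N), ∫⁻ x : Fin N → ℝ, (weylChamber N).indicator G (x ∘ σ) :=
        lintegral_finsetSum _ fun σ _ =>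
          (hG.indicator hW).comp (measurePreserving_comp_perm σ).measurable
    _ = ∑ σ : Equiv.Perm (Fin N), ∫⁻ x, (weylChamber N).indicator G x :=
        Finset.sum_congr rfl fun σ _ =>
          (measurePreserving_comp_perm σ).lintegral_comp (hG.indicator hW)
    _ = _ := by
        simp [lintegral_indicator hW, Fintype.card_perm]

lemma integrable_gaussianKernel {V : Type*} [NormedAddCommGroup V] [NormedSpace ℝ V]
    [FiniteDimensional ℝ V] [MeasurableSpace V] [BorelSpace V] {ι : Type*} [Fintype ι]
    (ℓ : ι → V →L[ℝ] ℂ) (μ : Measure V) [μ.IsAddHaarMeasure] {b : ℝ}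
    (hb : 0 < b) (hQ : ∀ x, b * ‖x‖ ^ 2 ≤ quadForm ℓ x) {w : V → ℝ} {p : MvPolynomial ι ℂ}
    (hp : ∀ x, evalCoords ℓ p x = w x) :
    Integrable (fun x => w x * Real.exp (-quadForm ℓ x)) μ := by
  have := (integrable_evalCoords ℓ μ hb hQ p).re
  refine this.congr (Filter.Eventually.of_forall fun x => ?_)
  simp only [hp, ← Complex.ofReal_mul]
  exact Complex.ofReal_re _

lemma gaussianFunctional_eq_ofReal {V : Type*} [NormedAddCommGroup V] [NormedSpace ℝ V]
    [FiniteDimensional ℝ V] [MeasurableSpace V] [BorelSpace V] {ι : Type*} [Fintype ι]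
    (ℓ : ι → V →L[ℝ] ℂ) (μ : Measure V) [μ.IsAddHaarMeasure] {b : ℝ}
    (hb : 0 < b) (hQ : ∀ x, b * ‖x‖ ^ 2 ≤ quadForm ℓ x) {w : V → ℝ} {p : MvPolynomial ι ℂ}
    (hp : ∀ x, evalCoords ℓ p x = w x) :
    gaussianFunctional ℓ μ hb hQ p = ((∫ x, w x * Real.exp (-quadForm ℓ x) ∂μ : ℝ) : ℂ) := by
  rw [← integral_complex_ofReal]
  refine integral_congr_ae (Filter.Eventually.of_forall fun x => ?_)
  simp only [hp]
  push_cast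
  rfl

/-- The total mass of a Gaussian weight with continuous prefactor is positive. -/
lemma integral_gaussianKernel_pos {V : Type*} [NormedAddCommGroup V] [NormedSpace ℝ V]
    [FiniteDimensional ℝ V] [MeasurableSpace V] [BorelSpace V] {ι : Type*} [Fintype ι]
    (ℓ : ι → V →L[ℝ] ℂ) (μ : Measure V) [μ.IsAddHaarMeasure] {b : ℝ}
    (hb : 0 < b) (hQ : ∀ x, b * ‖x‖ ^ 2 ≤ quadForm ℓ x) {w : V → ℝ} {p : MvPolynomial ι ℂ}
    (hp : ∀ x, evalCoords ℓ p x = w x) (hw : ∀ x, 0 ≤ w x) (hwc : Continuous w) {x₀ : V}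
    (hx₀ : w x₀ ≠ 0) :
    0 < ∫ x, w x * Real.exp (-quadForm ℓ x) ∂μ := by
  have hc : Continuous fun x => w x * Real.exp (-quadForm ℓ x) :=
    hwc.mul (Real.continuous_exp.comp (continuous_quadForm ℓ).neg)
  have hnn : ∀ x, 0 ≤ w x * Real.exp (-quadForm ℓ x) := fun x =>
    mul_nonneg (hw x) (Real.exp_pos _).le
  refine lt_of_le_of_ne (integral_nonneg hnn) fun h => ?_
  have h0 := (integral_eq_zero_iff_of_nonneg hnn
    (integrable_gaussianKernel ℓ μ hb hQ hp)).1 h.symm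
  have h1 := (Continuous.ae_eq_iff_eq μ hc (continuous_const (y := (0 : ℝ)))).1 h0
  have h2 := congrFun h1 x₀
  simp [hx₀] at h2

/-- **Weyl integration formula** for Hermitian matrices and symmetric functions of the
eigenvalues. -/
lemma weyl_integration (N : ℕ) : ∃ κ : ENNReal, κ ≠ 0 ∧ κ ≠ ⊤ ∧
    ∀ F : (Fin N → ℝ) → ENNReal, Measurable F →
      (∀ (σ : Equiv.Perm (Fin N)) x, F (x ∘ σ) = F x) →
      ∫⁻ c : HermitianCoords N, F (eigenvaluesOfCoords c) =
        κ * ∫⁻ x in weylChamber N, F x * ENNReal.ofReal (vandermondeProd x ^ 2) := by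
  have hb : (0 : ℝ) < 1 / 2 := by norm_num
  have hp1 : ∀ c : HermitianCoords N, evalCoords (entryFamily N) 1 c = ((1 : ℝ) : ℂ) :=
    fun c => by simp [evalCoords]
  set a : ℝ := ∫ c : HermitianCoords N, 1 * Real.exp (-quadForm (entryFamily N) c) with ha
  set d : ℝ := ∫ x : Fin N → ℝ, vandermondeProd x ^ 2 * Real.exp (-quadForm (realFamily N) x)
    with hd
  have ha0 : 0 < a := integral_gaussianKernel_pos _ volume hb le_quadForm_entryFamily hp1
    (fun _ => zero_le_one) continuous_const (x₀ := 0) one_ne_zero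
  obtain ⟨x₀, hx₀⟩ := exists_vandermondeProd_ne_zero (N := N)
  have hd0 : 0 < d := integral_gaussianKernel_pos _ volume hb le_quadForm_realFamily
    eval_vandermondePoly (fun _ => sq_nonneg _) (continuous_vandermondeProd.pow 2) (x₀ := x₀)
    (pow_ne_zero 2 hx₀)
  have key := symmetrize_matrix_eq (N := N) a.toNNReal d.toNNReal
    (by
      rw [Real.coe_toNNReal a ha0.le]
      exact (gaussianFunctional_eq_ofReal _ volume hb le_quadForm_entryFamily hp1).symm)
    (by
      rw [Real.coe_toNNReal d hd0.le]
      exact (gaussianFunctional_eq_ofReal _ volume hb le_quadForm_realFamily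
        eval_vandermondePoly).symm)
  have hf0 : (N.factorial : ENNReal) ≠ 0 := by exact_mod_cast N.factorial_ne_zero
  have hft : (N.factorial : ENNReal) ≠ ⊤ := ENNReal.natCast_ne_top _
  have hd' : ENNReal.ofReal d ≠ 0 := by simpa using hd0
  refine ⟨ENNReal.ofReal a * N.factorial / ENNReal.ofReal d, ?_, ?_, fun F hF hsym => ?_⟩
  · refine ENNReal.div_ne_zero.2 ⟨mul_ne_zero (by simpa using ha0) hf0, ENNReal.ofReal_ne_top⟩
  · exact ENNReal.div_ne_top (ENNReal.mul_ne_top ENNReal.ofReal_ne_top hft) hd'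
  set E : (Fin N → ℝ) → ENNReal := fun x => ENNReal.ofReal (Real.exp (1 / 2 * ∑ i, x i ^ 2)) with hE
  have hEm : Measurable E := by
    refine Measurable.ennreal_ofReal (Continuous.measurable ?_)
    fun_prop
  have hEsym : ∀ (σ : Equiv.Perm (Fin N)) x, E (x ∘ σ) = E x := by
    intro σ x
    simp only [hE, Function.comp_apply]
    rw [Equiv.sum_comp σ fun i => x i ^ 2]
  have hFE : Measurable fun x => F x * E x := hF.mul hEm
  have hFEsym : ∀ (σ : Equiv.Perm (Fin N)) x, F (x ∘ σ) * E (x ∘ σ) = F x * E x :=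
    fun σ x => by rw [hsym, hEsym]
  have h1 := congrArg (fun m : Measure (Fin N → ℝ) => ∫⁻ x, F x * E x ∂m) key
  beta_reduce at h1
  rw [lintegral_smul_measure, lintegral_smul_measure,
    lintegral_symmetrize _ measurable_eigenvaluesOfCoords hFE hFEsym,
    lintegral_symmetrize _ measurable_id hFE hFEsym] at h1
  have hexp : ∀ (w q : ℝ), 0 ≤ w →
      ENNReal.ofReal (w * Real.exp (-q)) * ENNReal.ofReal (Real.exp q) =
      ENNReal.ofReal w := by
    intro w q hw
    rw [← ENNReal.ofReal_mul (by positivity), mul_assoc, ← Real.exp_add, neg_add_cancel,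
      Real.exp_zero, mul_one]
  have h2 : ∫⁻ c, F (eigenvaluesOfCoords c) * E (eigenvaluesOfCoords c)
      ∂(gaussianWeight (entryFamily N) volume fun _ => 1) =
      ∫⁻ c : HermitianCoords N, F (eigenvaluesOfCoords c) := by
    refine (lintegral_withDensity_eq_lintegral_mul _ ?_
      (hFE.comp measurable_eigenvaluesOfCoords)).trans ?_
    rotate_left
    · refine lintegral_congr fun c => ?_
      simp only [Pi.mul_apply, hE, Function.comp_apply]
      rw [mul_left_comm, quadForm_entryFamily, hexp _ _ zero_le_one]
      simp
    · exact (measurable_const.mul (Real.measurable_exp.comp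
        (continuous_quadForm _).measurable.neg)).ennreal_ofReal
  have h3 : ∫⁻ x, F (id x) * E (id x)
      ∂(gaussianWeight (realFamily N) volume fun x => vandermondeProd x ^ 2) =
      ∫⁻ x, F x * ENNReal.ofReal (vandermondeProd x ^ 2) := by
    refine (lintegral_withDensity_eq_lintegral_mul _ ?_ hFE).trans ?_
    rotate_left
    · refine lintegral_congr fun c => ?_
      simp only [Pi.mul_apply, hE]
      rw [mul_left_comm, quadForm_realFamily, hexp _ _ (sq_nonneg _)]
    · exact ((continuous_vandermondeProd.measurable.pow_const 2).mul (Real.measurable_exp.comp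
        (continuous_quadForm _).measurable.neg)).ennreal_ofReal
  have h4 := lintegral_eq_factorial_mul_weylChamber
    (G := fun x => F x * ENNReal.ofReal (vandermondeProd x ^ 2))
    (hF.mul (continuous_vandermondeProd.measurable.pow_const 2).ennreal_ofReal)
    (fun σ x => by rw [hsym, vandermondeProd_sq_comp_perm])
    (fun x hx => by simp [vandermondeProd_eq_zero_of_not_injective hx])
  rw [h2, h3, h4] at h1
  have hsa : ∀ (r : ℝ) (z : ENNReal), r.toNNReal • z = ENNReal.ofReal r * z := fun _ _ => rfl
  rw [hsa, hsa, mul_left_comm, mul_left_comm (ENNReal.ofReal a),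
    ENNReal.mul_right_inj hf0 hft] at h1
  rw [← ENNReal.mul_div_right_comm, ENNReal.eq_div_iff hd' ENNReal.ofReal_ne_top, h1, mul_assoc]

end WeylIntegration

/-! ### Hua's factorisation of the determinant -/

section HuaFactorization

/-- The pairs `i < j` of indices below `N + 1` are those below `N` together with the pairs
`(i, N)`. -/
noncomputable def upperPairEquiv (N : ℕ) : {p : Fin N × Fin N // p.1 < p.2} ⊕ Fin N ≃
    {p : Fin (N + 1) × Fin (N + 1) // p.1 < p.2} :=
  Equiv.ofBijective
    (Sum.elim (fun p => ⟨(p.1.1.castSucc, p.1.2.castSucc), p.2⟩)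
      fun i => ⟨(i.castSucc, Fin.last N), i.castSucc_lt_last⟩) <| by
    constructor
    · rintro (⟨⟨i, j⟩, h⟩ | i) (⟨⟨i', j'⟩, h'⟩ | i') hh
      · simp only [Sum.elim_inl, Subtype.mk.injEq, Prod.mk.injEq, Fin.castSucc_inj] at hh
        obtain ⟨rfl, rfl⟩ := hh
        rfl
      · simp only [Sum.elim_inl, Sum.elim_inr, Subtype.mk.injEq, Prod.mk.injEq] at hh
        exact absurd hh.2 (Fin.castSucc_lt_last j).ne
      · simp only [Sum.elim_inl, Sum.elim_inr, Subtype.mk.injEq, Prod.mk.injEq] at hh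
        exact absurd hh.2.symm (Fin.castSucc_lt_last j').ne
      · simp only [Sum.elim_inr, Subtype.mk.injEq, Prod.mk.injEq, Fin.castSucc_inj] at hh
        obtain ⟨rfl, -⟩ := hh
        rfl
    · rintro ⟨⟨i, j⟩, h⟩
      have hi : i ≠ Fin.last N := (lt_of_lt_of_le h (Fin.le_last j)).ne
      obtain ⟨i, rfl⟩ := Fin.exists_castSucc_eq.2 hi
      rcases Fin.eq_castSucc_or_eq_last j with ⟨j, rfl⟩ | rfl
      · exact ⟨Sum.inl ⟨(i, j), h⟩, rfl⟩
      · exact ⟨Sum.inr i, rfl⟩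

/-- The coordinates of an `(N + 1) × (N + 1)` Hermitian matrix, split into its corner, its last
column and its last diagonal entry. -/
noncomputable def glueEquiv (N : ℕ) :
    HermitianCoords N × ((Fin N → ℂ) × ℝ) ≃ᵐ HermitianCoords (N + 1) :=
  (MeasurableEquiv.prodAssoc.trans <|
    (MeasurableEquiv.prodCongr (MeasurableEquiv.refl _)
      (MeasurableEquiv.prodAssoc.symm.trans MeasurableEquiv.prodComm)).trans <|
    MeasurableEquiv.prodAssoc.symm.trans <|
    MeasurableEquiv.prodCongr
      (MeasurableEquiv.prodComm.trans
        (MeasurableEquiv.piFinSuccAbove (fun _ => ℝ) (Fin.last N)).symm)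
      ((MeasurableEquiv.sumPiEquivProdPi fun _ => ℂ).symm.trans
        (MeasurableEquiv.piCongrLeft (fun _ => ℂ) (upperPairEquiv N))))

lemma measurePreserving_glueEquiv (N : ℕ) :
    MeasurePreserving (glueEquiv N) volume volume := by
  refine MeasurePreserving.trans (e := MeasurableEquiv.prodAssoc) volume_preserving_prodAssoc ?_
  refine MeasurePreserving.trans (μb := volume) ?_ ?_
  · refine MeasurePreserving.prod (MeasurePreserving.id _) ?_
    exact MeasurePreserving.trans (e' := MeasurableEquiv.prodComm)
      (volume_preserving_prodAssoc.symm _) Measure.measurePreserving_swap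
  refine MeasurePreserving.trans (μb := volume)
    (volume_preserving_prodAssoc.symm MeasurableEquiv.prodAssoc) ?_
  refine MeasurePreserving.prod ?_ ?_
  · exact MeasurePreserving.trans (e := MeasurableEquiv.prodComm) Measure.measurePreserving_swap
      ((volume_preserving_piFinSuccAbove (fun _ => ℝ) (Fin.last N)).symm _)
  · exact MeasurePreserving.trans
      ((volume_measurePreserving_sumPiEquivProdPi fun _ => ℂ).symm _)
      (volume_measurePreserving_piCongrLeft (fun _ => ℂ) (upperPairEquiv N))

section glue

variable {N : ℕ} (c : HermitianCoords N) (v : Fin N → ℂ) (t : ℝ)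

lemma glueEquiv_diag_castSucc (i : Fin N) : (glueEquiv N (c, (v, t))).1 i.castSucc = c.1 i := by
  change (Fin.insertNthEquiv (fun _ => ℝ) (Fin.last N)) (t, c.1) i.castSucc = c.1 i
  simp [Fin.insertNthEquiv]

lemma glueEquiv_diag_last : (glueEquiv N (c, (v, t))).1 (Fin.last N) = t := by
  change (Fin.insertNthEquiv (fun _ => ℝ) (Fin.last N)) (t, c.1) (Fin.last N) = t
  simp [Fin.insertNthEquiv]

lemma glueEquiv_upper (q : {p : Fin N × Fin N // p.1 < p.2} ⊕ Fin N) :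
    (glueEquiv N (c, (v, t))).2 (upperPairEquiv N q) = Sum.elim c.2 v q := by
  change (MeasurableEquiv.piCongrLeft (fun _ => ℂ) (upperPairEquiv N))
    ((MeasurableEquiv.sumPiEquivProdPi fun _ => ℂ).symm (c.2, v)) (upperPairEquiv N q) = _
  rw [MeasurableEquiv.piCongrLeft_apply_apply]
  rcases q with q | q <;> rfl

lemma entryOfCoords_glue_castSucc (i j : Fin N) :
    entryOfCoords (glueEquiv N (c, (v, t))) i.castSucc j.castSucc = entryOfCoords c i j := by
  have hlt : ∀ i j : Fin N, i < j →
      entryOfCoords (glueEquiv N (c, (v, t))) i.castSucc j.castSucc = entryOfCoords c i j := by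
    intro i j h
    have h1 := entryOfCoords_upper (glueEquiv N (c, (v, t)))
      (upperPairEquiv N (Sum.inl ⟨(i, j), h⟩))
    rw [glueEquiv_upper] at h1
    exact h1.trans (entryOfCoords_upper c ⟨(i, j), h⟩).symm
  rcases lt_trichotomy i j with h | rfl | h
  · exact hlt i j h
  · rw [entryOfCoords_diag, entryOfCoords_diag, glueEquiv_diag_castSucc]
  · rw [entryOfCoords_star _ j.castSucc, entryOfCoords_star _ j, hlt j i h]

lemma entryOfCoords_glue_last (i : Fin N) :
    entryOfCoords (glueEquiv N (c, (v, t))) i.castSucc (Fin.last N) = v i := by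
  have h1 := entryOfCoords_upper (glueEquiv N (c, (v, t))) (upperPairEquiv N (Sum.inr i))
  rw [glueEquiv_upper] at h1
  exact h1

end glue

/-- The Cayley-type matrix `1 + iH`. -/
noncomputable def onePlusI {N : ℕ} (c : HermitianCoords N) : Matrix (Fin N) (Fin N) ℂ :=
  1 + Complex.I • (hermitianOfCoords c).1

/-- The positive number `det (1 + H²)`. -/
noncomputable def detOneAddSq {N : ℕ} (c : HermitianCoords N) : ℝ :=
  (1 + (hermitianOfCoords c).1 ^ 2).det.re

/-- The real number `w* H w`. -/
noncomputable def hermitianForm {N : ℕ} (c : HermitianCoords N) (w : Fin N → ℂ) : ℝ :=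
  (star w ⬝ᵥ (hermitianOfCoords c).1.mulVec w).re

section

variable {N : ℕ}

lemma detOneAddSq_pos (c : HermitianCoords N) : 0 < detOneAddSq c := by
  rw [detOneAddSq, det_one_add_sq]
  have : (∏ i, (1 + (orderedEigenvalues (hermitianOfCoords c) i : ℂ) ^ 2)) =
    ((∏ i, (1 + orderedEigenvalues (hermitianOfCoords c) i ^ 2) : ℝ) : ℂ) := by push_cast; rfl
  rw [this, Complex.ofReal_re]
  exact Finset.prod_pos fun i _ => by positivity

lemma conjTranspose_onePlusI (c : HermitianCoords N) :
    (onePlusI c).conjTranspose = 1 - Complex.I • (hermitianOfCoords c).1 := by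
  rw [onePlusI, Matrix.conjTranspose_add, Matrix.conjTranspose_smul, (hermitianOfCoords c).2.eq]
  simp [sub_eq_add_neg]

lemma detOneAddSq_eq_normSq (c : HermitianCoords N) :
    detOneAddSq c = Complex.normSq (onePlusI c).det := by
  have h : 1 + (hermitianOfCoords c).1 ^ 2 = onePlusI c * (onePlusI c).conjTranspose := by
    rw [conjTranspose_onePlusI, onePlusI]
    simp only [mul_sub, add_mul, mul_one, one_mul, smul_mul_smul_comm, Complex.I_mul_I, pow_two,
      neg_one_smul]
    abel
  rw [detOneAddSq, h, Matrix.det_mul, Matrix.det_conjTranspose]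
  change ((onePlusI c).det * (starRingEnd ℂ) (onePlusI c).det).re = _
  rw [Complex.mul_conj, Complex.ofReal_re]

lemma det_onePlusI_ne_zero (c : HermitianCoords N) : (onePlusI c).det ≠ 0 := by
  intro h
  have := detOneAddSq_pos c
  rw [detOneAddSq_eq_normSq, h, map_zero] at this
  exact this.false

lemma coe_hermitianForm (c : HermitianCoords N) (w : Fin N → ℂ) :
    (hermitianForm c w : ℂ) = star w ⬝ᵥ (hermitianOfCoords c).1.mulVec w := by
  refine Complex.ext (by simp [hermitianForm]) ?_
  have := (hermitianOfCoords c).2.im_star_dotProduct_mulVec_self w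
  simpa using this.symm

/-- The parametrisation of the last column and diagonal entry in which `det (1 + H²)`
factorises. -/
noncomputable def extend (x : HermitianCoords N × ((Fin N → ℂ) × ℝ)) : HermitianCoords (N + 1) :=
  glueEquiv N (x.1, ((onePlusI x.1).mulVec x.2.1, x.2.2 + hermitianForm x.1 x.2.1))

/-- The factor contributed to `det (1 + H²)` by the last row and column. -/
noncomputable def columnFactor (ξ : (Fin N → ℂ) × ℝ) : ℝ :=
  (1 + ∑ i, ‖ξ.1 i‖ ^ 2) ^ 2 + ξ.2 ^ 2

lemma columnFactor_pos (ξ : (Fin N → ℂ) × ℝ) : 0 < columnFactor ξ := by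
  unfold columnFactor; positivity

lemma onePlusI_glue_reindex (c : HermitianCoords N) (v : Fin N → ℂ) (t : ℝ) :
    (onePlusI (glueEquiv N (c, (v, t)))).submatrix finSumFinEquiv finSumFinEquiv =
      Matrix.fromBlocks (onePlusI c) (Matrix.of fun i (_ : Fin 1) => Complex.I * v i)
        (Matrix.of fun (_ : Fin 1) j => Complex.I * star (v j))
        (Matrix.of fun (_ _ : Fin 1) => 1 + Complex.I * t) := by
  have hl : ∀ x : Fin 1, Fin.natAdd N x = Fin.last N := by
    intro x; ext; simp
  ext (i | i) (j | j)
  · simp only [Matrix.submatrix_apply, finSumFinEquiv_apply_left, Matrix.fromBlocks_apply₁₁,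
      onePlusI,
      Matrix.add_apply, Matrix.smul_apply, hermitianOfCoords_apply]
    change (1 : Matrix _ _ ℂ) i.castSucc j.castSucc + _ • entryOfCoords _ i.castSucc j.castSucc = _
    rw [entryOfCoords_glue_castSucc]
    simp [Matrix.one_apply]
  · simp only [Matrix.submatrix_apply, finSumFinEquiv_apply_left, finSumFinEquiv_apply_right,
      Matrix.fromBlocks_apply₁₂, onePlusI, Matrix.add_apply, Matrix.smul_apply,
      hermitianOfCoords_apply, hl]
    change (1 : Matrix _ _ ℂ) i.castSucc (Fin.last N) +
      _ • entryOfCoords _ i.castSucc (Fin.last N) = _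
    rw [entryOfCoords_glue_last, Matrix.one_apply_ne (Fin.castSucc_lt_last i).ne]
    simp
  · simp only [Matrix.submatrix_apply, finSumFinEquiv_apply_left, finSumFinEquiv_apply_right,
      Matrix.fromBlocks_apply₂₁, onePlusI, Matrix.add_apply, Matrix.smul_apply,
      hermitianOfCoords_apply, hl]
    change (1 : Matrix _ _ ℂ) (Fin.last N) j.castSucc +
      _ • entryOfCoords _ (Fin.last N) j.castSucc = _
    rw [entryOfCoords_star _ j.castSucc, entryOfCoords_glue_last,
      Matrix.one_apply_ne (Fin.castSucc_lt_last j).ne']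
    simp
  · simp only [Matrix.submatrix_apply, finSumFinEquiv_apply_right,
      Matrix.fromBlocks_apply₂₂, onePlusI, Matrix.add_apply, Matrix.smul_apply,
      hermitianOfCoords_apply, hl, entryOfCoords_diag, glueEquiv_diag_last]
    simp

/-- Hua's factorisation, from the Schur complement of the corner in `1 + iH`. -/
lemma detOneAddSq_extend (c : HermitianCoords N) (ξ : (Fin N → ℂ) × ℝ) :
    detOneAddSq (extend (c, ξ)) = detOneAddSq c * columnFactor ξ := by
  obtain ⟨w, t⟩ := ξ
  rw [detOneAddSq_eq_normSq, detOneAddSq_eq_normSq c, extend]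
  dsimp only
  rw [← Matrix.det_submatrix_equiv_self finSumFinEquiv, onePlusI_glue_reindex]
  have hu : IsUnit (onePlusI c).det := (det_onePlusI_ne_zero c).isUnit
  have := Matrix.invertibleOfIsUnitDet _ hu
  rw [Matrix.det_fromBlocks₁₁, map_mul]
  congr 1
  rw [Matrix.det_unique]
  -- The column of the inverse block is `i w`, since the last column is `(1 + iH) w`.
  have h1 : ⅟(onePlusI c) * (Matrix.of fun i (_ : Fin 1) => Complex.I * (onePlusI c).mulVec w i) =
      Matrix.of fun i (_ : Fin 1) => Complex.I * w i := by
    have : (Matrix.of fun i (_ : Fin 1) => Complex.I * (onePlusI c).mulVec w i) =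
        onePlusI c * Matrix.of fun i (_ : Fin 1) => Complex.I * w i := by
      ext i j
      simp only [Matrix.of_apply, Matrix.mul_apply, Matrix.mulVec, dotProduct, Finset.mul_sum]
      exact Finset.sum_congr rfl fun _ _ => by ring
    rw [this, ← Matrix.mul_assoc, invOf_mul_self, Matrix.one_mul]
  rw [Matrix.mul_assoc, h1]
  have h2 : ∑ j, star ((onePlusI c).mulVec w j) * w j =
      (∑ i, ‖w i‖ ^ 2 : ℝ) - Complex.I * hermitianForm c w := by
    have h3 : ∑ j, star ((onePlusI c).mulVec w j) * w j =
        star w ⬝ᵥ ((onePlusI c).conjTranspose.mulVec w) := by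
      rw [Matrix.dotProduct_mulVec, ← Matrix.star_mulVec]
      rfl
    rw [h3, conjTranspose_onePlusI, Matrix.sub_mulVec, dotProduct_sub, Matrix.one_mulVec,
      Matrix.smul_mulVec, dotProduct_smul, ← coe_hermitianForm, smul_eq_mul]
    congr 1
    simp only [dotProduct, Pi.star_apply]
    push_cast
    exact Finset.sum_congr rfl fun i _ => Complex.conj_mul' _
  have h4 : ((Matrix.of fun (_ _ : Fin 1) => 1 + Complex.I * ((t + hermitianForm c w : ℝ) : ℂ)) -
      (Matrix.of fun (_ : Fin 1) j => Complex.I * star ((onePlusI c).mulVec w j)) *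
        (Matrix.of fun i (_ : Fin 1) => Complex.I * w i)) default default =
      ((1 + ∑ i, ‖w i‖ ^ 2 : ℝ) : ℂ) + (t : ℝ) * Complex.I := by
    rw [Matrix.sub_apply, Matrix.mul_apply]
    simp only [Matrix.of_apply]
    have h5 : ∑ j, Complex.I * star ((onePlusI c).mulVec w j) * (Complex.I * w j) =
        -∑ j, star ((onePlusI c).mulVec w j) * w j := by
      rw [← Finset.sum_neg_distrib]
      refine Finset.sum_congr rfl fun j _ => ?_
      linear_combination (star ((onePlusI c).mulVec w j) * w j) * Complex.I_mul_I
    rw [h5, h2]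
    push_cast
    ring
  rw [h4, Complex.normSq_add_mul_I]
  rfl

end

end HuaFactorization

/-! ### The Hua-Pickrell measure as a product of columns -/

section HuaMeasure

variable {N : ℕ}

lemma continuous_entryOfCoords (i j : Fin N) :
    Continuous fun c : HermitianCoords N => entryOfCoords c i j :=
  (entryCLM i j).continuous

lemma continuous_hermitianOfCoords_val :
    Continuous fun c : HermitianCoords N => (hermitianOfCoords c).1 :=
  continuous_matrix fun i j => continuous_entryOfCoords i j

lemma continuous_detOneAddSq : Continuous (detOneAddSq : HermitianCoords N → ℝ) := by
  unfold detOneAddSq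
  exact Complex.continuous_re.comp
    ((continuous_const.add (continuous_hermitianOfCoords_val.pow 2)).matrix_det)

lemma continuous_onePlusI : Continuous (onePlusI : HermitianCoords N → _) := by
  unfold onePlusI
  exact continuous_const.add (continuous_hermitianOfCoords_val.fun_const_smul Complex.I)

lemma continuous_hermitianForm :
    Continuous fun x : HermitianCoords N × (Fin N → ℂ) => hermitianForm x.1 x.2 := by
  unfold hermitianForm
  exact Complex.continuous_re.comp (Continuous.dotProduct continuous_snd.star
    (Continuous.matrix_mulVec (continuous_hermitianOfCoords_val.comp continuous_fst)
      continuous_snd))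

lemma measurable_extend :
    Measurable (extend : HermitianCoords N × ((Fin N → ℂ) × ℝ) → HermitianCoords (N + 1)) := by
  unfold extend
  refine (glueEquiv N).measurable.comp (Continuous.measurable ?_)
  refine continuous_fst.prodMk (Continuous.prodMk ?_ ?_)
  · exact Continuous.matrix_mulVec (continuous_onePlusI.comp continuous_fst)
      (continuous_fst.comp continuous_snd)
  · exact (continuous_snd.comp continuous_snd).add (continuous_hermitianForm.comp
      (continuous_fst.prodMk (continuous_fst.comp continuous_snd)))

lemma measurable_columnFactor : Measurable (columnFactor : (Fin N → ℂ) × ℝ → ℝ) := by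
  unfold columnFactor
  exact (by fun_prop : Continuous _).measurable

/-- The change of variables for the last column and diagonal entry: the linear map `1 + iH` on
`ℂᴺ` has real Jacobian `|det (1 + iH)|² = det (1 + H²)`. -/
lemma lintegral_column_changeOfVariables (c : HermitianCoords N)
    {Φ : (Fin N → ℂ) × ℝ → ENNReal} (hΦ : Measurable Φ) :
    ∫⁻ ξ, Φ ξ = ENNReal.ofReal (detOneAddSq c) *
      ∫⁻ ξ : (Fin N → ℂ) × ℝ, Φ ((onePlusI c).mulVec ξ.1, ξ.2 + hermitianForm c ξ.1) := by
  set f : (Fin N → ℂ) →ₗ[ℝ] (Fin N → ℂ) := (Matrix.toLin' (onePlusI c)).restrictScalars ℝ with hf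
  have hdet : LinearMap.det f = detOneAddSq c := by
    rw [hf, LinearMap.det_restrictScalars, LinearMap.det_toLin', Algebra.norm_complex_apply,
      detOneAddSq_eq_normSq]
  have hpos := detOneAddSq_pos c
  have hmap := Measure.map_linearMap_addHaar_eq_smul_addHaar (μ := (volume : Measure (Fin N → ℂ)))
    (f := f) (by rw [hdet]; exact hpos.ne')
  rw [hdet, abs_of_pos (inv_pos.2 hpos)] at hmap
  have hfm : Measurable f := (LinearMap.continuous_of_finiteDimensional f).measurable
  have hm2 : Measurable fun ξ : (Fin N → ℂ) × ℝ =>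
      ((onePlusI c).mulVec ξ.1, ξ.2 + hermitianForm c ξ.1) := by
    refine Continuous.measurable (Continuous.prodMk ?_ ?_)
    · exact Continuous.matrix_mulVec continuous_const continuous_fst
    · exact continuous_snd.add (continuous_hermitianForm.comp
        (continuous_const.prodMk continuous_fst))
  have h1 : ∫⁻ ξ : (Fin N → ℂ) × ℝ, Φ ((onePlusI c).mulVec ξ.1, ξ.2 + hermitianForm c ξ.1) =
      ∫⁻ w, ∫⁻ t, Φ (f w, t) := by
    rw [Measure.volume_eq_prod]
    refine (lintegral_prod _ (hΦ.comp hm2).aemeasurable).trans ?_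
    refine lintegral_congr fun w => ?_
    exact lintegral_add_right_eq_self (μ := volume) (fun t => Φ (f w, t)) (hermitianForm c w)
  have h2 : ∫⁻ w, ∫⁻ t, Φ (f w, t) =
      ENNReal.ofReal (detOneAddSq c)⁻¹ * ∫⁻ w, ∫⁻ t, Φ (w, t) := by
    rw [← smul_eq_mul, ← lintegral_smul_measure, ← hmap,
      lintegral_map hΦ.lintegral_prod_right' hfm]
  rw [h1, h2, ← mul_assoc, ← ENNReal.ofReal_mul hpos.le, mul_inv_cancel₀ hpos.ne',
    ENNReal.ofReal_one, one_mul, Measure.volume_eq_prod, lintegral_prod _ hΦ.aemeasurable]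

/-- The unnormalised Hua-Pickrell measure in coordinates. -/
noncomputable def coordsMeasure (N : ℕ) (s : ℝ) : Measure (HermitianCoords N) :=
  volume.withDensity fun c => ENNReal.ofReal (detOneAddSq c ^ (-s - (N : ℝ)))

/-- The unnormalised law of the parameters of the `(N + 1)`-st column and diagonal entry. -/
noncomputable def columnMeasure (N : ℕ) (s : ℝ) : Measure ((Fin N → ℂ) × ℝ) :=
  volume.withDensity fun ξ => ENNReal.ofReal (columnFactor ξ ^ (-s - ((N + 1 : ℕ) : ℝ)))

lemma measurable_coordsDensity (s : ℝ) : Measurable fun c : HermitianCoords N =>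
    ENNReal.ofReal (detOneAddSq c ^ (-s - (N : ℝ))) :=
  (continuous_detOneAddSq.measurable.pow_const _).ennreal_ofReal

lemma measurable_columnDensity (s : ℝ) : Measurable fun ξ : (Fin N → ℂ) × ℝ =>
    ENNReal.ofReal (columnFactor ξ ^ (-s - ((N + 1 : ℕ) : ℝ))) :=
  (measurable_columnFactor.pow_const _).ennreal_ofReal

instance instSFiniteCoordsMeasure (N : ℕ) (s : ℝ) : SFinite (coordsMeasure N s) := by
  unfold coordsMeasure; infer_instance

instance instSFiniteColumnMeasure (N : ℕ) (s : ℝ) : SFinite (columnMeasure N s) := by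
  unfold columnMeasure; infer_instance

/-- In the parametrisation `extend`, the Hua-Pickrell measure of size `N + 1` is a product of the
one of size `N` and an independent column. -/
lemma coordsMeasure_succ (N : ℕ) (s : ℝ) :
    coordsMeasure (N + 1) s = ((coordsMeasure N s).prod (columnMeasure N s)).map extend := by
  refine Measure.ext_of_lintegral _ fun F hF => ?_
  set α : ℝ := -s - ((N + 1 : ℕ) : ℝ) with hα
  have hα' : -s - (N : ℝ) = 1 + α := by rw [hα]; push_cast; ring
  rw [lintegral_map hF measurable_extend]
  have hprod : (coordsMeasure N s).prod (columnMeasure N s) =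
      (volume : Measure (HermitianCoords N × ((Fin N → ℂ) × ℝ))).withDensity fun x =>
        ENNReal.ofReal (detOneAddSq x.1 ^ (-s - (N : ℝ))) * ENNReal.ofReal (columnFactor x.2 ^ α) :=
    prod_withDensity (measurable_coordsDensity s) (measurable_columnDensity s)
  have hd : Measurable fun x : HermitianCoords N × ((Fin N → ℂ) × ℝ) =>
      ENNReal.ofReal (detOneAddSq x.1 ^ (-s - (N : ℝ))) * ENNReal.ofReal (columnFactor x.2 ^ α) :=
    ((measurable_coordsDensity s).comp measurable_fst).mul
      ((measurable_columnDensity s).comp measurable_snd)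
  have hW := measurable_coordsDensity (N := N + 1) s
  have hG : Measurable fun c => (fun c : HermitianCoords (N + 1) =>
      ENNReal.ofReal (detOneAddSq c ^ α)) c * F c := hW.mul hF
  calc ∫⁻ c, F c ∂(coordsMeasure (N + 1) s)
      = ∫⁻ c : HermitianCoords (N + 1), ENNReal.ofReal (detOneAddSq c ^ α) * F c :=
        lintegral_withDensity_eq_lintegral_mul _ hW hF
    _ = ∫⁻ x, ENNReal.ofReal (detOneAddSq (glueEquiv N x) ^ α) * F (glueEquiv N x) :=
        ((measurePreserving_glueEquiv N).lintegral_comp hG).symm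
    _ = ∫⁻ c, ∫⁻ ξ, ENNReal.ofReal (detOneAddSq (glueEquiv N (c, ξ)) ^ α) *
          F (glueEquiv N (c, ξ)) := by
        rw [Measure.volume_eq_prod]
        exact lintegral_prod _ (hG.comp (glueEquiv N).measurable).aemeasurable
    _ = ∫⁻ c, ∫⁻ ξ, (ENNReal.ofReal (detOneAddSq c ^ (-s - (N : ℝ))) *
          ENNReal.ofReal (columnFactor ξ ^ α)) * F (extend (c, ξ)) := by
        refine lintegral_congr fun c => ?_
        refine (lintegral_column_changeOfVariables c
          (hG.comp ((glueEquiv N).measurable.comp measurable_prodMk_left))).trans ?_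
        rw [← lintegral_const_mul' _ _ ENNReal.ofReal_ne_top]
        refine lintegral_congr fun ξ => ?_
        have h1 : glueEquiv N (c, ((onePlusI c).mulVec ξ.1, ξ.2 + hermitianForm c ξ.1)) =
          extend (c, ξ) := rfl
        simp only [Function.comp_apply]
        rw [h1, detOneAddSq_extend, ← mul_assoc]
        congr 1
        have hp := detOneAddSq_pos c
        rw [← ENNReal.ofReal_mul hp.le, ← ENNReal.ofReal_mul (by positivity), hα',
          Real.mul_rpow hp.le (columnFactor_pos ξ).le, Real.rpow_add hp, Real.rpow_one]
        ring_nf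
    _ = ∫⁻ x, (ENNReal.ofReal (detOneAddSq x.1 ^ (-s - (N : ℝ))) *
          ENNReal.ofReal (columnFactor x.2 ^ α)) * F (extend x) := by
        rw [Measure.volume_eq_prod]
        exact (lintegral_prod _ (hd.mul (hF.comp measurable_extend)).aemeasurable).symm
    _ = _ := by
        rw [hprod]
        exact (lintegral_withDensity_eq_lintegral_mul _ hd (hF.comp measurable_extend)).symm

lemma columnMeasure_univ_ne_zero (N : ℕ) (s : ℝ) : columnMeasure N s Set.univ ≠ 0 := by
  rw [columnMeasure, withDensity_apply _ MeasurableSet.univ, Measure.restrict_univ]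
  intro h
  rw [lintegral_eq_zero_iff (measurable_columnDensity s)] at h
  obtain ⟨ξ, hξ⟩ := h.exists
  have := Real.rpow_pos_of_pos (columnFactor_pos ξ) (-s - ((N + 1 : ℕ) : ℝ))
  simp only [Pi.zero_apply, ENNReal.ofReal_eq_zero] at hξ
  exact absurd hξ (not_le.2 this)

lemma columnMeasure_univ_ne_top (N : ℕ) {s : ℝ} (hs : -(1 / 2) < s) :
    columnMeasure N s Set.univ ≠ ⊤ := by
  rw [columnMeasure, withDensity_apply _ MeasurableSet.univ, Measure.restrict_univ]
  set p : ℝ := s + N + 1 with hp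
  -- The exponent is split as `p = r₁ / 4 + r₂ / 2`, with `r₁ > 2N` and `r₂ > 1`.
  set δ : ℝ := 2 * p - N - 1 with hδ
  have hN : (0 : ℝ) ≤ N := by positivity
  have hδ0 : 0 < δ := by rw [hδ, hp]; linarith
  have h1 : Integrable fun w : Fin N → ℂ => (1 + ‖w‖ ^ 2) ^ (-(2 * N + δ) / 2) :=
    integrable_rpow_neg_one_add_norm_sq (r := 2 * N + δ) (by
      rw [Module.finrank_pi_fintype]
      simp
      linarith)
  have h2 : Integrable fun t : ℝ => (1 + ‖t‖ ^ 2) ^ (-(1 + δ / 2) / 2) :=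
    integrable_rpow_neg_one_add_norm_sq (r := 1 + δ / 2) (by
      rw [Module.finrank_self]
      push_cast
      linarith)
  have h3 := h1.mul_prod h2
  rw [← Measure.volume_eq_prod] at h3
  refine ((lintegral_mono fun ξ => ENNReal.ofReal_le_ofReal ?_).trans_lt h3.lintegral_lt_top).ne
  have hK := columnFactor_pos ξ
  have ha : ‖ξ.1‖ ^ 2 ≤ ∑ i, ‖ξ.1 i‖ ^ 2 := by
    have h : ‖ξ.1‖ ≤ √(∑ i, ‖ξ.1 i‖ ^ 2) :=
      (pi_norm_le_iff_of_nonneg (Real.sqrt_nonneg _)).2 fun i => Real.le_sqrt_of_sq_le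
        (Finset.single_le_sum (f := fun i => ‖ξ.1 i‖ ^ 2) (fun _ _ => by positivity)
          (Finset.mem_univ i))
    calc ‖ξ.1‖ ^ 2 ≤ √(∑ i, ‖ξ.1 i‖ ^ 2) ^ 2 := by gcongr
      _ = _ := Real.sq_sqrt (by positivity)
  have hK1 : (1 + ‖ξ.1‖ ^ 2) ^ (2 : ℝ) ≤ columnFactor ξ := by
    unfold columnFactor
    rw [Real.rpow_two]
    have : (1 + ‖ξ.1‖ ^ 2) ^ 2 ≤ (1 + ∑ i, ‖ξ.1 i‖ ^ 2) ^ 2 := by gcongr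
    nlinarith [sq_nonneg ξ.2]
  have hK2 : 1 + ‖ξ.2‖ ^ 2 ≤ columnFactor ξ := by
    unfold columnFactor
    rw [Real.norm_eq_abs, sq_abs]
    have : 0 ≤ ∑ i, ‖ξ.1 i‖ ^ 2 := by positivity
    nlinarith
  have hsplit : -s - ((N + 1 : ℕ) : ℝ) = -(2 * N + δ) / 4 + -(1 + δ / 2) / 2 := by
    rw [hδ, hp]; push_cast; ring
  rw [hsplit, Real.rpow_add hK]
  have e1 : columnFactor ξ ^ (-(2 * N + δ) / 4) ≤ (1 + ‖ξ.1‖ ^ 2) ^ (-(2 * N + δ) / 2) := by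
    have := Real.rpow_le_rpow_of_nonpos (by positivity) hK1
      (z := -(2 * N + δ) / 4) (by linarith)
    rw [← Real.rpow_mul (by positivity)] at this
    convert this using 2
    ring
  have e2 : columnFactor ξ ^ (-(1 + δ / 2) / 2) ≤ (1 + ‖ξ.2‖ ^ 2) ^ (-(1 + δ / 2) / 2) :=
    Real.rpow_le_rpow_of_nonpos (by positivity) hK2 (by linarith)
  exact mul_le_mul e1 e2 (by positivity) (by positivity)

lemma coordsMeasure_univ_zero (s : ℝ) : coordsMeasure 0 s Set.univ = 1 := by
  rw [coordsMeasure, withDensity_apply _ MeasurableSet.univ, Measure.restrict_univ]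
  have h : ∀ c : HermitianCoords 0, ENNReal.ofReal (detOneAddSq c ^ (-s - ((0 : ℕ) : ℝ))) = 1 := by
    intro c
    simp [detOneAddSq]
  simp only [h]
  rw [lintegral_one, Measure.volume_eq_prod, ← Set.univ_prod_univ, Measure.prod_prod]
  have h2 : ∀ (ι α : Type) [Fintype ι] [IsEmpty ι] [MeasureSpace α]
      [SigmaFinite (volume : Measure α)], (volume : Measure (ι → α)) Set.univ = 1 := by
    intro ι α _ _ _ _
    rw [volume_pi, Measure.pi_of_empty]
    simp
  rw [h2, h2, one_mul]

lemma coordsMeasure_univ_succ (N : ℕ) (s : ℝ) : coordsMeasure (N + 1) s Set.univ =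
    coordsMeasure N s Set.univ * columnMeasure N s Set.univ := by
  rw [coordsMeasure_succ, Measure.map_apply measurable_extend MeasurableSet.univ,
    Set.preimage_univ, ← Set.univ_prod_univ, Measure.prod_prod]

lemma coordsMeasure_univ_ne_zero (N : ℕ) (s : ℝ) : coordsMeasure N s Set.univ ≠ 0 := by
  induction N with
  | zero => rw [coordsMeasure_univ_zero]; exact one_ne_zero
  | succ N ih =>
    rw [coordsMeasure_univ_succ]
    exact mul_ne_zero ih (columnMeasure_univ_ne_zero N s)

lemma coordsMeasure_univ_ne_top (N : ℕ) {s : ℝ} (hs : -(1 / 2) < s) :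
    coordsMeasure N s Set.univ ≠ ⊤ := by
  induction N with
  | zero => rw [coordsMeasure_univ_zero]; exact ENNReal.one_ne_top
  | succ N ih =>
    rw [coordsMeasure_univ_succ]
    exact ENNReal.mul_ne_top ih (columnMeasure_univ_ne_top N hs)

end HuaMeasure

/-! ### The Pearson IV normalising constant -/

section PearsonConstant

/-- The integral `∫ (1 + x²)⁻ᵃ dx = √π Γ(a - 1/2) / Γ(a)`, from writing `Γ(a) (1 + x²)⁻ᵃ` as
`∫ u ^ (a - 1) exp (-(1 + x²) u) du` and integrating over `x` first. -/
lemma lintegral_one_add_sq_rpow_neg {a : ℝ} (ha : 1 / 2 < a) :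
    ENNReal.ofReal (Real.Gamma a) * ∫⁻ x : ℝ, ENNReal.ofReal ((1 + x ^ 2) ^ (-a)) =
      ENNReal.ofReal (√Real.pi * Real.Gamma (a - 1 / 2)) := by
  have ha0 : 0 < a := by linarith
  have hint : ∀ (b r : ℝ), 0 < b → 0 < r →
      ∫⁻ u in Set.Ioi (0 : ℝ), ENNReal.ofReal (u ^ (b - 1) * Real.exp (-(r * u))) =
        ENNReal.ofReal ((1 / r) ^ b * Real.Gamma b) := by
    intro b r hb hr
    rw [← Real.integral_rpow_mul_exp_neg_mul_Ioi hb hr, ofReal_integral_eq_lintegral_ofReal]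
    · by_contra hni
      have h := Real.integral_rpow_mul_exp_neg_mul_Ioi hb hr
      rw [integral_undef hni] at h
      have := Real.Gamma_pos_of_pos hb
      have : 0 < (1 / r) ^ b * Real.Gamma b := by positivity
      linarith
    · refine (ae_restrict_iff' measurableSet_Ioi).2 (Filter.Eventually.of_forall fun u hu => ?_)
      have : (0 : ℝ) < u := hu
      positivity
  calc ENNReal.ofReal (Real.Gamma a) * ∫⁻ x : ℝ, ENNReal.ofReal ((1 + x ^ 2) ^ (-a))
      = ∫⁻ x : ℝ, ∫⁻ u in Set.Ioi (0 : ℝ),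
          ENNReal.ofReal (u ^ (a - 1) * Real.exp (-((1 + x ^ 2) * u))) := by
        rw [← lintegral_const_mul' _ _ ENNReal.ofReal_ne_top]
        refine lintegral_congr fun x => ?_
        have hx : 0 < 1 + x ^ 2 := by positivity
        rw [hint a _ ha0 hx, ← ENNReal.ofReal_mul (Real.Gamma_pos_of_pos ha0).le, mul_comm,
          one_div, Real.inv_rpow hx.le, Real.rpow_neg hx.le]
    _ = ∫⁻ u in Set.Ioi (0 : ℝ), ∫⁻ x : ℝ,
          ENNReal.ofReal (u ^ (a - 1) * Real.exp (-((1 + x ^ 2) * u))) := by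
        refine lintegral_lintegral_swap (Measurable.aemeasurable ?_)
        simp only [Function.uncurry_def]
        fun_prop
    _ = ∫⁻ u in Set.Ioi (0 : ℝ), ENNReal.ofReal √Real.pi *
          ENNReal.ofReal (u ^ (a - 1 / 2 - 1) * Real.exp (-(1 * u))) := by
        refine setLIntegral_congr_fun measurableSet_Ioi fun u hu => ?_
        have hu0 : (0 : ℝ) < u := hu
        have h1 : ∀ x : ℝ, ENNReal.ofReal (u ^ (a - 1) * Real.exp (-((1 + x ^ 2) * u))) =
            ENNReal.ofReal (u ^ (a - 1) * Real.exp (-(1 * u))) *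
              ENNReal.ofReal (Real.exp (-u * x ^ 2)) := by
          intro x
          rw [← ENNReal.ofReal_mul (by positivity), mul_assoc, ← Real.exp_add]
          ring_nf
        simp only [h1]
        rw [lintegral_const_mul' _ _ ENNReal.ofReal_ne_top, ← ofReal_integral_eq_lintegral_ofReal
          (integrable_exp_neg_mul_sq hu0)
            (Filter.Eventually.of_forall fun _ => (Real.exp_pos _).le),
          integral_gaussian, ← ENNReal.ofReal_mul (by positivity),
          ← ENNReal.ofReal_mul (by positivity)]
        congr 1
        have h2 : a - 1 / 2 - 1 = (a - 1) + -(1 / 2) := by ring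
        rw [h2, Real.rpow_add hu0, Real.rpow_neg hu0.le, ← Real.sqrt_eq_rpow,
          Real.sqrt_div Real.pi_pos.le]
        field_simp
    _ = _ := by
        rw [lintegral_const_mul' _ _ ENNReal.ofReal_ne_top, hint _ 1 (by linarith) one_pos,
          ← ENNReal.ofReal_mul (by positivity)]
        simp

/-- The normalising constant of the Pearson IV distribution, by the duplication formula. -/
lemma lintegral_pearson_density {s : ℝ} (hs : -(1 / 2) < s) :
    ENNReal.ofReal ((2 : ℝ) ^ (2 * s) * Real.Gamma (s + 1) ^ 2 /
      (Real.pi * Real.Gamma (2 * s + 1))) *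
      ∫⁻ x : ℝ, ENNReal.ofReal ((1 + x ^ 2) ^ (-s - 1)) = 1 := by
  have h := lintegral_one_add_sq_rpow_neg (a := s + 1) (by linarith)
  have hneg : ∀ x : ℝ, (1 + x ^ 2) ^ (-s - 1) = (1 + x ^ 2) ^ (-(s + 1)) := by
    intro x; congr 1; ring
  simp only [hneg]
  have hG1 : 0 < Real.Gamma (s + 1) := Real.Gamma_pos_of_pos (by linarith)
  have hG2 : 0 < Real.Gamma (2 * s + 1) := Real.Gamma_pos_of_pos (by linarith)
  have hG3 : 0 < Real.Gamma (s + 1 - 1 / 2) := Real.Gamma_pos_of_pos (by linarith)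
  have hdup := Real.Gamma_mul_Gamma_add_half (s + 1 - 1 / 2)
  have e1 : s + 1 - 1 / 2 + 1 / 2 = s + 1 := by ring
  have e2 : 2 * (s + 1 - 1 / 2) = 2 * s + 1 := by ring
  have e3 : 1 - (2 * s + 1) = -(2 * s) := by ring
  rw [e1, e2, e3, Real.rpow_neg (by norm_num)] at hdup
  have hpow : (0 : ℝ) < 2 ^ (2 * s) := by positivity
  have hc : (2 : ℝ) ^ (2 * s) * Real.Gamma (s + 1) ^ 2 / (Real.pi * Real.Gamma (2 * s + 1)) =
      (2 : ℝ) ^ (2 * s) * Real.Gamma (s + 1) / (Real.pi * Real.Gamma (2 * s + 1)) *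
        Real.Gamma (s + 1) := by ring
  rw [hc, ENNReal.ofReal_mul (by positivity), mul_assoc, h, ← ENNReal.ofReal_mul (by positivity),
    ← ENNReal.ofReal_one]
  congr 1
  have hpi : √Real.pi * √Real.pi = Real.pi := Real.mul_self_sqrt Real.pi_pos.le
  have : (2 : ℝ) ^ (2 * s) * Real.Gamma (s + 1) / (Real.pi * Real.Gamma (2 * s + 1)) *
      (√Real.pi * Real.Gamma (s + 1 - 1 / 2)) = (2 : ℝ) ^ (2 * s) * √Real.pi /
        (Real.pi * Real.Gamma (2 * s + 1)) *
      (Real.Gamma (s + 1 - 1 / 2) * Real.Gamma (s + 1)) := by ring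
  rw [this, hdup]
  field_simp
  rw [sq, hpi]

end PearsonConstant

/-! ### The infinite matrix -/

section InfiniteMatrix

section normalize

variable {α β : Type*} [MeasurableSpace α] [MeasurableSpace β]

lemma isProbabilityMeasure_normalize {μ : Measure α} (h0 : μ Set.univ ≠ 0) (ht : μ Set.univ ≠ ⊤) :
    IsProbabilityMeasure (normalize μ) :=
  ⟨by rw [normalize, Measure.smul_apply, smul_eq_mul, ENNReal.inv_mul_cancel h0 ht]⟩

lemma normalize_map {μ : Measure α} {f : α → β} (hf : Measurable f) :
    normalize (μ.map f) = (normalize μ).map f := by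
  rw [normalize, normalize, Measure.map_smul, Measure.map_apply hf MeasurableSet.univ,
    Set.preimage_univ]

lemma normalize_prod {μ : Measure α} {ν : Measure β} [SFinite μ] [SFinite ν]
    (hμ0 : μ Set.univ ≠ 0) (hμt : μ Set.univ ≠ ⊤) :
    normalize (μ.prod ν) = (normalize μ).prod (normalize ν) := by
  rw [normalize, normalize, normalize, Measure.prod_smul_left, Measure.prod_smul_right, smul_smul,
    ← Set.univ_prod_univ, Measure.prod_prod, ENNReal.mul_inv (Or.inl hμ0) (Or.inl hμt)]

end normalize

lemma measurable_detOneAddSq_matrix {N : ℕ} (s : ℝ) :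
    Measurable fun H : HermitianMatrix (Fin N) =>
      ENNReal.ofReal ((1 + H.1 ^ 2).det.re ^ (-s - (N : ℝ))) := by
  refine ((Complex.measurable_re.comp ?_).pow_const _).ennreal_ofReal
  simp only [Matrix.det_apply]
  refine Finset.measurable_sum _ fun σ _ => ?_
  refine Measurable.const_smul (Finset.measurable_prod _ fun i _ => ?_) _
  simp only [Matrix.add_apply, pow_two, Matrix.mul_apply]
  exact measurable_const.add (Finset.measurable_sum _ fun k _ =>
    (measurable_val_entry _ _).mul (measurable_val_entry _ _))

/-- The normalised Hua-Pickrell measure in coordinates. -/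
noncomputable def coordsLaw (N : ℕ) (s : ℝ) : Measure (HermitianCoords N) :=
  normalize (coordsMeasure N s)

lemma matrixMeasure_eq_map (N : ℕ) (s : ℝ) :
    matrixMeasure N s = (coordsLaw N s).map hermitianOfCoords := by
  rw [coordsLaw, ← normalize_map (measurable_hermitianOfCoords N), matrixMeasure]
  congr 1
  refine Measure.ext_of_lintegral _ fun F hF => ?_
  have hm := measurable_detOneAddSq_matrix (N := N) s
  rw [lintegral_withDensity_eq_lintegral_mul _ hm hF, hermitianLebesgue,
    lintegral_map (hm.mul hF) (measurable_hermitianOfCoords N),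
    lintegral_map hF (measurable_hermitianOfCoords N)]
  exact (lintegral_withDensity_eq_lintegral_mul _ (measurable_coordsDensity s)
    (hF.comp (measurable_hermitianOfCoords N))).symm

/-- The sample space for the successive columns of the infinite matrix. -/
abbrev ColumnSpace : Type := ∀ N : ℕ, (Fin N → ℂ) × ℝ

/-- The law of the `N`-th column parameters. -/
noncomputable def columnLaw (s : ℝ) (N : ℕ) : Measure ((Fin N → ℂ) × ℝ) :=
  normalize (columnMeasure N s)

/-- The law of a sequence of independent column parameters. -/
noncomputable def columnsLaw (s : ℝ) : Measure ColumnSpace :=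
  Measure.infinitePi (columnLaw s)

/-- The `N × N` corner built from the first `N` columns. -/
noncomputable def cornerCoords : (N : ℕ) → ColumnSpace → HermitianCoords N
  | 0, _ => 0
  | N + 1, ω => extend (cornerCoords N ω, ω N)

lemma measurable_cornerCoords (N : ℕ) : Measurable (cornerCoords N) := by
  induction N with
  | zero => exact measurable_const
  | succ N ih => exact measurable_extend.comp (ih.prodMk (measurable_pi_apply N))

lemma cornerCoords_congr {N : ℕ} {ω ω' : ColumnSpace} (h : ∀ k < N, ω k = ω' k) :
    cornerCoords N ω = cornerCoords N ω' := by
  induction N with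
  | zero => rfl
  | succ N ih =>
    rw [cornerCoords, cornerCoords, ih fun k hk => h k (by omega), h N (by omega)]

section law

variable {s : ℝ} (hs : -(1 / 2) < s)

include hs

lemma isProbabilityMeasure_columnLaw (N : ℕ) : IsProbabilityMeasure (columnLaw s N) :=
  isProbabilityMeasure_normalize (columnMeasure_univ_ne_zero N s) (columnMeasure_univ_ne_top N hs)

lemma isProbabilityMeasure_columnsLaw : IsProbabilityMeasure (columnsLaw s) := by
  have := isProbabilityMeasure_columnLaw hs
  unfold columnsLaw
  infer_instance

lemma map_eval_columnsLaw (N : ℕ) : (columnsLaw s).map (fun ω => ω N) = columnLaw s N := by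
  have := isProbabilityMeasure_columnLaw hs
  exact Measure.infinitePi_map_eval (columnLaw s) N

lemma indepFun_cornerCoords (N : ℕ) :
    IndepFun (cornerCoords N) (fun ω => ω N) (columnsLaw s) := by
  have := isProbabilityMeasure_columnLaw hs
  have hi : iIndepFun (fun (k : ℕ) (ω : ColumnSpace) => ω k) (columnsLaw s) :=
    iIndepFun_infinitePi (P := columnLaw s) (X := fun _ x => x) (fun _ => measurable_id)
  have h := hi.indepFun_finset (Finset.range N) {N} (by simp)
    fun k => measurable_pi_apply k
  let g : (∀ k : Finset.range N, (Fin k → ℂ) × ℝ) → HermitianCoords N := fun r =>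
    cornerCoords N fun k => if hk : k ∈ Finset.range N then r ⟨k, hk⟩ else 0
  have hg : Measurable g := by
    refine (measurable_cornerCoords N).comp (measurable_pi_iff.2 fun k => ?_)
    split_ifs with hk
    · exact measurable_pi_apply _
    · exact measurable_const
  have h2 := h.comp hg (measurable_pi_apply ⟨N, by simp⟩)
  have h3 : cornerCoords N = g ∘ fun (ω : ColumnSpace) (k : Finset.range N) => ω k := by
    funext ω
    refine cornerCoords_congr fun k hk => ?_
    simp [hk]
  rw [h3]
  exact h2

/-- The `N × N` corner of the constructed infinite matrix has the Hua-Pickrell law. -/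
lemma map_cornerCoords (N : ℕ) : (columnsLaw s).map (cornerCoords N) = coordsLaw N s := by
  have := isProbabilityMeasure_columnsLaw hs
  induction N with
  | zero =>
    have h1 : IsProbabilityMeasure (coordsLaw 0 s) := isProbabilityMeasure_normalize
      (coordsMeasure_univ_ne_zero 0 s) (coordsMeasure_univ_ne_top 0 hs)
    have h2 : IsProbabilityMeasure ((columnsLaw s).map (cornerCoords 0)) :=
      Measure.isProbabilityMeasure_map (measurable_cornerCoords 0).aemeasurable
    refine Measure.ext fun S _ => ?_
    rcases S.eq_empty_or_nonempty with rfl | hS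
    · simp
    · rw [Subsingleton.eq_univ_of_nonempty hS, measure_univ, measure_univ]
  | succ N ih =>
    have h1 : cornerCoords (N + 1) = extend ∘ fun ω => (cornerCoords N ω, ω N) := rfl
    have h2 := (indepFun_iff_map_prod_eq_prod_map_map (measurable_cornerCoords N).aemeasurable
      (measurable_pi_apply N).aemeasurable).1 (indepFun_cornerCoords hs N)
    rw [h1, ← Measure.map_map measurable_extend
      ((measurable_cornerCoords N).prodMk (measurable_pi_apply N)), h2, ih,
      map_eval_columnsLaw hs, coordsLaw, coordsLaw, columnLaw, coordsMeasure_succ,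
      normalize_map measurable_extend, normalize_prod (coordsMeasure_univ_ne_zero N s)
        (coordsMeasure_univ_ne_top N hs)]

end law

lemma entryOfCoords_cornerCoords_le {N M : ℕ} (h : N ≤ M) (ω : ColumnSpace) (i j : Fin N) :
    entryOfCoords (cornerCoords M ω) (i.castLE h) (j.castLE h) =
      entryOfCoords (cornerCoords N ω) i j := by
  induction M, h using Nat.le_induction with
  | base => rfl
  | succ M h ih => exact (entryOfCoords_glue_castSucc _ _ _ (i.castLE h) (j.castLE h)).trans ih

lemma entryOfCoords_cornerCoords_eq {N M : ℕ} (ω : ColumnSpace) (i j : ℕ) (hi : i < N) (hj : j < N)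
    (hi' : i < M) (hj' : j < M) :
    entryOfCoords (cornerCoords M ω) ⟨i, hi'⟩ ⟨j, hj'⟩ =
      entryOfCoords (cornerCoords N ω) ⟨i, hi⟩ ⟨j, hj⟩ := by
  rcases le_total N M with h | h
  · exact entryOfCoords_cornerCoords_le h ω ⟨i, hi⟩ ⟨j, hj⟩
  · exact (entryOfCoords_cornerCoords_le h ω ⟨i, hi'⟩ ⟨j, hj'⟩).symm

/-- The infinite Hermitian matrix whose corners are `cornerCoords N ω`. -/
noncomputable def infiniteMatrix (ω : ColumnSpace) : HermitianMatrix ℕ :=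
  ⟨Matrix.of fun i j => entryOfCoords (cornerCoords (i + j + 1) ω) ⟨i, by omega⟩ ⟨j, by omega⟩, by
    ext i j
    rw [Matrix.conjTranspose_apply, Matrix.of_apply, Matrix.of_apply, ← entryOfCoords_star]
    exact entryOfCoords_cornerCoords_eq ω i j _ _ _ _⟩

lemma infiniteMatrix_apply (ω : ColumnSpace) {N : ℕ} (i j : Fin N) :
    (infiniteMatrix ω).1 i j = entryOfCoords (cornerCoords N ω) i j :=
  entryOfCoords_cornerCoords_eq ω i j _ _ _ _

lemma measurable_infiniteMatrix : Measurable infiniteMatrix := by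
  refine Measurable.subtype_mk (measurable_pi_iff.2 fun i => measurable_pi_iff.2 fun j => ?_)
  exact (continuous_entryOfCoords _ _).measurable.comp (measurable_cornerCoords _)

lemma corner_infiniteMatrix (N : ℕ) (ω : ColumnSpace) :
    corner N (infiniteMatrix ω) = hermitianOfCoords (cornerCoords N ω) := by
  refine Subtype.ext ?_
  ext i j : 2
  exact infiniteMatrix_apply ω i j

lemma isInfiniteHuaPickrell_infiniteMatrix {s : ℝ} (hs : -(1 / 2) < s) :
    IsInfiniteHuaPickrell s infiniteMatrix (columnsLaw s) := by
  refine ⟨measurable_infiniteMatrix, fun N _ => ⟨?_, ?_⟩⟩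
  · exact ((measurable_corner N).comp measurable_infiniteMatrix).aemeasurable
  · have h : (fun ω => corner N (infiniteMatrix ω)) = hermitianOfCoords ∘ cornerCoords N :=
      funext (corner_infiniteMatrix N)
    rw [h, ← Measure.map_map (measurable_hermitianOfCoords N) (measurable_cornerCoords N),
      map_cornerCoords hs, matrixMeasure_eq_map]

end InfiniteMatrix

/-! ### Exchangeability, the diagonal and the trace -/

section Diagonal

section Permutation

variable {N : ℕ}

/-- Simultaneous permutation of rows and columns, as a linear map on coordinates. -/
noncomputable def permuteCoords (σ : Equiv.Perm (Fin N)) :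
    HermitianCoords N →ₗ[ℝ] HermitianCoords N where
  toFun c := coordsOfMatrix ((hermitianOfCoords c).1.submatrix σ σ)
  map_add' c d := by
    have h : ∀ i j, entryOfCoords (c + d) i j = entryOfCoords c i j + entryOfCoords d i j :=
      fun i j => (entryCLM i j).map_add c d
    refine Prod.ext (funext fun i => ?_) (funext fun p => ?_) <;>
      simp [coordsOfMatrix, hermitianOfCoords_apply, h]
  map_smul' r c := by
    have h : ∀ i j, entryOfCoords (r • c) i j = r • entryOfCoords c i j :=
      fun i j => (entryCLM i j).map_smul r c
    refine Prod.ext (funext fun i => ?_) (funext fun p => ?_) <;>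
      simp [coordsOfMatrix, hermitianOfCoords_apply, h]

lemma entryOfCoords_permuteCoords (σ : Equiv.Perm (Fin N)) (c : HermitianCoords N) (i j : Fin N) :
    entryOfCoords (permuteCoords σ c) i j = entryOfCoords c (σ i) (σ j) :=
  entryOfCoords_coordsOfMatrix ((hermitianOfCoords c).2.submatrix σ) i j

lemma permuteCoords_diag (σ : Equiv.Perm (Fin N)) (c : HermitianCoords N) (i : Fin N) :
    (permuteCoords σ c).1 i = c.1 (σ i) := by
  have := entryOfCoords_permuteCoords σ c i i
  rwa [entryOfCoords_diag, entryOfCoords_diag, Complex.ofReal_inj] at this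

lemma permuteCoords_pow (σ : Equiv.Perm (Fin N)) (m : ℕ) :
    permuteCoords σ ^ m = permuteCoords (σ ^ m) := by
  induction m with
  | zero =>
    refine LinearMap.ext fun c => coords_ext fun i j => ?_
    simp [entryOfCoords_permuteCoords]
  | succ m ih =>
    refine LinearMap.ext fun c => coords_ext fun i j => ?_
    rw [pow_succ, ih, Module.End.mul_apply, entryOfCoords_permuteCoords,
      entryOfCoords_permuteCoords, entryOfCoords_permuteCoords, pow_succ']
    rfl

/-- Permuting rows and columns preserves Lebesgue measure, because a linear map of finite order
has determinant of absolute value one. -/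
lemma map_permuteCoords_volume (σ : Equiv.Perm (Fin N)) :
    (volume : Measure (HermitianCoords N)).map (permuteCoords σ) = volume := by
  have h1 : LinearMap.det (permuteCoords σ) ^ orderOf σ = 1 := by
    rw [← map_pow, permuteCoords_pow, pow_orderOf_eq_one]
    have : permuteCoords (1 : Equiv.Perm (Fin N)) = 1 := by
      have := permuteCoords_pow (1 : Equiv.Perm (Fin N)) 0
      simpa using this.symm
    rw [this, map_one]
  have h2 : |LinearMap.det (permuteCoords σ)| = 1 := by
    have : |LinearMap.det (permuteCoords σ)| ^ orderOf σ = 1 := by rw [← abs_pow, h1, abs_one]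
    exact (pow_eq_one_iff_of_nonneg (abs_nonneg _) (orderOf_pos σ).ne').1 this
  have h3 : LinearMap.det (permuteCoords σ) ≠ 0 := by
    intro h
    rw [h, abs_zero] at h2
    exact zero_ne_one h2
  rw [Measure.map_linearMap_addHaar_eq_smul_addHaar _ h3, abs_inv, h2]
  simp

lemma detOneAddSq_permuteCoords (σ : Equiv.Perm (Fin N)) (c : HermitianCoords N) :
    detOneAddSq (permuteCoords σ c) = detOneAddSq c := by
  have h : onePlusI (permuteCoords σ c) = (onePlusI c).submatrix σ σ := by
    ext i j : 2
    simp [onePlusI, hermitianOfCoords_apply, entryOfCoords_permuteCoords, Matrix.one_apply]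
  rw [detOneAddSq_eq_normSq, h, Matrix.det_submatrix_equiv_self, ← detOneAddSq_eq_normSq]

lemma measurable_permuteCoords (σ : Equiv.Perm (Fin N)) : Measurable (permuteCoords σ) :=
  (LinearMap.continuous_of_finiteDimensional (permuteCoords σ)).measurable

lemma map_permuteCoords_coordsLaw (s : ℝ) (σ : Equiv.Perm (Fin N)) :
    (coordsLaw N s).map (permuteCoords σ) = coordsLaw N s := by
  rw [coordsLaw, ← normalize_map (measurable_permuteCoords σ)]
  congr 1
  refine Measure.ext_of_lintegral _ fun F hF => ?_
  have hm := measurable_coordsDensity (N := N) s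
  rw [lintegral_map hF (measurable_permuteCoords σ), coordsMeasure,
    lintegral_withDensity_eq_lintegral_mul _ hm hF]
  refine (lintegral_withDensity_eq_lintegral_mul _ hm
    (hF.comp (measurable_permuteCoords σ))).trans ?_
  conv_rhs => rw [← map_permuteCoords_volume σ, lintegral_map (hm.mul hF)
    (measurable_permuteCoords σ)]
  refine lintegral_congr fun c => ?_
  simp [detOneAddSq_permuteCoords]

end Permutation

/-- The diagonal of the constructed infinite matrix. -/
noncomputable def diagonalProcess (i : ℕ) (ω : ColumnSpace) : ℝ :=
  (cornerCoords (i + 1) ω).1 (Fin.last i)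

lemma coe_diagonalProcess (i : ℕ) (ω : ColumnSpace) :
    (diagonalProcess i ω : ℂ) = (infiniteMatrix ω).1 i i := by
  have := infiniteMatrix_apply ω (Fin.last i) (Fin.last i)
  rw [entryOfCoords_diag] at this
  exact this.symm

lemma diagonalProcess_eq {N : ℕ} (i : Fin N) (ω : ColumnSpace) :
    diagonalProcess i ω = (cornerCoords N ω).1 i := by
  have h := coe_diagonalProcess i ω
  rw [infiniteMatrix_apply ω i i, entryOfCoords_diag, Complex.ofReal_inj] at h
  exact h

lemma measurable_diagonalProcess (i : ℕ) : Measurable (diagonalProcess i) :=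
  (measurable_pi_apply _).comp (measurable_fst.comp (measurable_cornerCoords _))

section law

variable {s : ℝ} (hs : -(1 / 2) < s)

include hs

lemma isExchangeable_diagonalProcess : IsExchangeable diagonalProcess (columnsLaw s) := by
  refine ⟨measurable_diagonalProcess, fun N σ => ⟨?_, ?_, ?_⟩⟩
  · exact (measurable_pi_iff.2 fun i => measurable_diagonalProcess _).aemeasurable
  · exact (measurable_pi_iff.2 fun i => measurable_diagonalProcess _).aemeasurable
  have h1 : (fun ω (i : Fin N) => diagonalProcess i ω) = Prod.fst ∘ cornerCoords N := by
    funext ω i; exact diagonalProcess_eq i ω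
  have h2 : (fun ω (i : Fin N) => diagonalProcess (σ i) ω) =
      Prod.fst ∘ permuteCoords σ ∘ cornerCoords N := by
    funext ω i
    rw [diagonalProcess_eq]
    exact (permuteCoords_diag σ _ i).symm
  rw [h1, h2, ← Measure.map_map measurable_fst
    ((measurable_permuteCoords σ).comp (measurable_cornerCoords N)),
    ← Measure.map_map (measurable_permuteCoords σ) (measurable_cornerCoords N),
    ← Measure.map_map measurable_fst (measurable_cornerCoords N), map_cornerCoords hs,
    map_permuteCoords_coordsLaw]

lemma map_diagonalProcess_eq (i : ℕ) :
    (columnsLaw s).map (diagonalProcess i) = (columnsLaw s).map (diagonalProcess 0) := by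
  have h := (isExchangeable_diagonalProcess hs).2 (i + 1) (Equiv.swap 0 (Fin.last i))
  have h2 := (h.comp (measurable_pi_apply (0 : Fin (i + 1)))).map_eq
  simpa [Function.comp_def] using h2

lemma map_diagonalProcess_zero : (columnsLaw s).map (diagonalProcess 0) = pearsonIV s := by
  have h0 : diagonalProcess 0 = Prod.snd ∘ fun ω : ColumnSpace => ω 0 := by
    funext ω
    have h : diagonalProcess 0 ω = (extend (cornerCoords 0 ω, ω 0)).1 (Fin.last 0) := rfl
    rw [h, extend, glueEquiv_diag_last]
    simp [hermitianForm]
  have hsnd : (columnMeasure 0 s).map Prod.snd =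
      volume.withDensity fun x : ℝ => ENNReal.ofReal ((1 + x ^ 2) ^ (-s - 1)) := by
    refine Measure.ext_of_lintegral _ fun F hF => ?_
    have hm : Measurable fun x : ℝ => ENNReal.ofReal ((1 + x ^ 2) ^ (-s - 1)) := by fun_prop
    rw [lintegral_map hF measurable_snd, lintegral_withDensity_eq_lintegral_mul _ hm hF]
    refine (lintegral_withDensity_eq_lintegral_mul _ (measurable_columnDensity s)
      (hF.comp measurable_snd)).trans ?_
    rw [Measure.volume_eq_prod]
    refine (lintegral_prod _ ((measurable_columnDensity s).mul
      (hF.comp measurable_snd)).aemeasurable).trans ?_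
    have : (volume : Measure (Fin 0 → ℂ)) Set.univ = 1 := by
      rw [volume_pi, Measure.pi_of_empty]
      simp
    simp [columnFactor, this]
  rw [h0, ← Measure.map_map measurable_snd (measurable_pi_apply 0), map_eval_columnsLaw hs,
    columnLaw, ← normalize_map measurable_snd, hsnd, normalize]
  have hm : Measurable fun x : ℝ => ENNReal.ofReal ((1 + x ^ 2) ^ (-s - 1)) := by fun_prop
  have h1 := lintegral_pearson_density hs
  rw [withDensity_apply _ MeasurableSet.univ, Measure.restrict_univ,
    ← ENNReal.eq_inv_of_mul_eq_one_left h1, ← withDensity_smul _ hm, pearsonIV]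
  congr 1
  funext x
  have hG2 : 0 < Real.Gamma (2 * s + 1) := Real.Gamma_pos_of_pos (by linarith)
  rw [Pi.smul_apply, smul_eq_mul, ← ENNReal.ofReal_mul (by positivity), one_div, ← Real.rpow_neg
    (by positivity)]
  congr 3
  ring

lemma hasLaw_diagonalProcess (i : ℕ) :
    HasLaw (diagonalProcess i) (pearsonIV s) (columnsLaw s) :=
  ⟨(measurable_diagonalProcess i).aemeasurable, by
    rw [map_diagonalProcess_eq hs, map_diagonalProcess_zero hs]⟩

end law

section trace

variable {N : ℕ}

lemma sum_eigenvaluesOfCoords (c : HermitianCoords N) :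
    ∑ i, eigenvaluesOfCoords c i = ∑ i, c.1 i := by
  have h := trace_pow_eq_sum (hermitianOfCoords c) 1
  simp only [pow_one, Matrix.trace, Matrix.diag_apply, hermitianOfCoords_apply,
    entryOfCoords_diag] at h
  unfold eigenvaluesOfCoords
  exact_mod_cast h.symm

lemma detOneAddSq_eq_prod (c : HermitianCoords N) :
    detOneAddSq c = ∏ i, (1 + eigenvaluesOfCoords c i ^ 2) := by
  have h := det_one_add_sq (hermitianOfCoords c)
  have h2 : (∏ i, (1 + (orderedEigenvalues (hermitianOfCoords c) i : ℂ) ^ 2)) =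
    ((∏ i, (1 + orderedEigenvalues (hermitianOfCoords c) i ^ 2) : ℝ) : ℂ) := by push_cast; rfl
  rw [detOneAddSq, h, h2, Complex.ofReal_re]
  rfl

/-- The Hua-Pickrell measure on the Weyl chamber before normalisation. -/
noncomputable def chamberMeasure (N : ℕ) (s : ℝ) : Measure (Fin N → ℝ) :=
  (volume.restrict (weylChamber N)).withDensity fun x =>
    ENNReal.ofReal ((∏ j : Fin N, 1 / (1 + x j ^ 2) ^ ((N : ℝ) + s)) * vandermondeProd x ^ 2)

/-- The trace has the same law, up to one normalising constant, under the two unnormalised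
Hua-Pickrell measures. -/
lemma exists_map_trace_eq (N : ℕ) (s : ℝ) : ∃ κ : ENNReal, κ ≠ 0 ∧ κ ≠ ⊤ ∧
    (coordsMeasure N s).map (fun c => ∑ i, c.1 i) =
      κ • (chamberMeasure N s).map (fun x => ∑ i, x i) := by
  obtain ⟨κ, h0, ht, h⟩ := weyl_integration N
  refine ⟨κ, h0, ht, Measure.ext_of_lintegral _ fun F hF => ?_⟩
  have hsum : Measurable fun x : Fin N → ℝ => ∑ i, x i := by fun_prop
  have hsum' : Measurable fun c : HermitianCoords N => ∑ i, c.1 i := hsum.comp measurable_fst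
  have hw : Measurable fun x : Fin N → ℝ =>
      ENNReal.ofReal ((∏ j : Fin N, (1 + x j ^ 2)) ^ (-s - (N : ℝ))) := by fun_prop
  have hd : Measurable fun x : Fin N → ℝ =>
      ENNReal.ofReal
        ((∏ j : Fin N, 1 / (1 + x j ^ 2) ^ ((N : ℝ) + s)) * vandermondeProd x ^ 2) := by
    refine Measurable.ennreal_ofReal (Measurable.mul ?_
      (continuous_vandermondeProd.measurable.pow_const 2))
    fun_prop
  rw [lintegral_map hF hsum', lintegral_smul_measure, lintegral_map hF hsum, smul_eq_mul]
  have key := h (fun x => ENNReal.ofReal ((∏ j : Fin N, (1 + x j ^ 2)) ^ (-s - (N : ℝ))) *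
    F (∑ i, x i)) (hw.mul (hF.comp hsum)) (fun σ x => by
      simp only [Function.comp_apply]
      rw [Equiv.sum_comp σ x, Equiv.prod_comp σ fun j => (1 + x j ^ 2)])
  simp only [← detOneAddSq_eq_prod, sum_eigenvaluesOfCoords] at key
  refine (lintegral_withDensity_eq_lintegral_mul _ (measurable_coordsDensity s)
    (hF.comp hsum')).trans (key.trans ?_)
  congr 1
  refine Eq.trans ?_ (lintegral_withDensity_eq_lintegral_mul _ hd (hF.comp hsum)).symm
  refine lintegral_congr fun x => ?_
  simp only [Pi.mul_apply, Function.comp_apply]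
  have hprod : (∏ j : Fin N, (1 + x j ^ 2)) ^ (-s - (N : ℝ)) =
      ∏ j : Fin N, 1 / (1 + x j ^ 2) ^ ((N : ℝ) + s) := by
    rw [← Real.finsetProd_rpow _ _ fun i _ => by positivity]
    refine Finset.prod_congr rfl fun j _ => ?_
    rw [one_div, ← Real.rpow_neg (by positivity)]
    congr 1
    ring
  rw [hprod, ENNReal.ofReal_mul (Finset.prod_nonneg fun j _ => by positivity)]
  ring

lemma map_sum_weylMeasure (N : ℕ) (s : ℝ) :
    (weylMeasure N s).map (fun x => ∑ i, x i) = (coordsLaw N s).map (fun c => ∑ i, c.1 i) := by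
  have hsum : Measurable fun x : Fin N → ℝ => ∑ i, x i := by fun_prop
  have hsum' : Measurable fun c : HermitianCoords N => ∑ i, c.1 i := hsum.comp measurable_fst
  obtain ⟨κ, h0, ht, h⟩ := exists_map_trace_eq N s
  have hw : weylMeasure N s = normalize (chamberMeasure N s) := rfl
  rw [hw, coordsLaw, ← normalize_map hsum, ← normalize_map hsum', h, normalize, normalize,
    Measure.smul_apply, smul_eq_mul, smul_smul, ENNReal.mul_inv (Or.inl h0) (Or.inl ht),
    mul_right_comm, ENNReal.inv_mul_cancel h0 ht, one_mul]

end trace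

end Diagonal

end HuaPickrell

theorem proposition2p7 (s : ℝ) (hs : -(1 / 2) < s) :
    ∃ (Ω : Type) (_ : MeasurableSpace Ω) (P : MeasureTheory.Measure Ω)
      (H : Ω → HuaPickrell.HermitianMatrix ℕ) (d : ℕ → Ω → ℝ),
      MeasureTheory.IsProbabilityMeasure P ∧
      HuaPickrell.IsInfiniteHuaPickrell s H P ∧
      (∀ i ω, ((d i ω : ℝ) : ℂ) = (H ω).1 i i) ∧
      HuaPickrell.IsExchangeable d P ∧
      (∀ i, ProbabilityTheory.HasLaw (d i) (HuaPickrell.pearsonIV s) P) ∧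
      (∀ N : ℕ, 1 ≤ N → ProbabilityTheory.IdentDistrib
        (fun x : Fin N → ℝ => ∑ i : Fin N, x i) (fun ω => ∑ i : Fin N, d i ω)
        (HuaPickrell.weylMeasure N s) P) := by
  refine ⟨HuaPickrell.ColumnSpace, inferInstance, HuaPickrell.columnsLaw s,
    HuaPickrell.infiniteMatrix,
    HuaPickrell.diagonalProcess,
    HuaPickrell.isProbabilityMeasure_columnsLaw hs,
    HuaPickrell.isInfiniteHuaPickrell_infiniteMatrix hs,
    HuaPickrell.coe_diagonalProcess,
    HuaPickrell.isExchangeable_diagonalProcess hs,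
    HuaPickrell.hasLaw_diagonalProcess hs,
    fun N _ => ⟨?_, ?_, ?_⟩⟩
  · exact (by fun_prop : Measurable fun x : Fin N → ℝ => ∑ i, x i).aemeasurable
  · exact (Finset.measurable_sum _ fun (i : Fin N) _ =>
      HuaPickrell.measurable_diagonalProcess i).aemeasurable
  · have h : (fun ω => ∑ i : Fin N, HuaPickrell.diagonalProcess i ω) =
        (fun c : HuaPickrell.HermitianCoords N => ∑ i, c.1 i) ∘ HuaPickrell.cornerCoords N := by
      funext ω
      exact Finset.sum_congr rfl fun i _ => HuaPickrell.diagonalProcess_eq i ω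
    rw [HuaPickrell.map_sum_weylMeasure, h, ← MeasureTheory.Measure.map_map ?_
      (HuaPickrell.measurable_cornerCoords N),
      HuaPickrell.map_cornerCoords hs]
    exact (by fun_prop : Measurable fun x : Fin N → ℝ => ∑ i, x i).comp measurable_fst
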